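/- Let $\mathfrak{h}_3$ be the three-dimensional real Heisenberg algebra, $\mathfrak{g}=\mathfrak{h}_3\oplus\mathfrak{h}_3$ and $\mathfrak{z}$ the centre of $\mathfrak{g}$. Let $d:\Lambda^k\mathfrak{g}^*\to\Lambda^{k+1}\mathfrak{g}^*$ be the Chevalley--Eilenberg differential (the exterior derivative of left-invariant forms). A form $\alpha\in\Lambda^k\mathfrak{g}^*$ is called stable if its orbit under $\mathrm{GL}(\mathfrak{g})$ is open in $\Lambda^k\mathfrak{g}^*$. Let $\omega\in\Lambda^2\mathfrak{g}^*$ and $\rho\in\Lambda^3\mathfrak{g}^*$ be stable, put $\sigma=\frac12\omega^2$, and orient $\mathfrak{g}$ by the volume form $\nu=\frac16\omega^3$. Define $K_\rho\in\mathrm{End}(\mathfrak{g})$ by $(K_\rho v)\lrcorner\,\nu=(v\lrcorner\rho)\wedge\rho$, and set $\lambda(\rho)=\frac16\operatorname{tr}(K_\rho^2)$ (nonzero, since $\rho$ is stable), $J_\rho=|\lambda(\rho)|^{-1/2}K_\rho$ and $\hat\rho=J_\rho^*\rho$. The pair $(\omega,\rho)$ is a half-flat $H^{\varepsilon,\tau}$-structure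 (an $\mathrm{SU}(3)$-, $\mathrm{SU}(1,2)$- or $\mathrm{SL}(3,\mathbb{R})$-structure, not necessarily normalised) if $$\omega\wedge\rho=0,\qquad \hat\rho\wedge\rho=\tfrac{c}{3}\,\omega^3\ \text{ for some constant } c>0,\qquad d\rho=0,\qquad d\sigma=0 .$$ A solution of the Hitchin flow on an interval $I$ is a differentiable family $(\omega(t),\rho(t))_{t\in I}$ of pairs of stable forms on $\mathfrak{g}$ with $$\dot\rho=d\omega,\qquad \dot\sigma=d\hat\rho,\qquad \sigma=\tfrac12\omega^2 .$$ Proposition. Let $(\omega_0,\rho_0)$ be any half-flat $H^{\varepsilon,\tau}$-structure on $\mathfrak{g}=\mathfrak{h}_3\oplus\mathfrak{h}_3$ with $\omega_0(\mathfrak{z},\mathfrak{z})=0$, and let $\sigma_0=\frac12\omega_0^2$. Then there is a solution $(\omega(t),\rho(t))$ of the Hitchin flow with $(\omega(0),\rho(0))=(\omega_0,\rho_0)$ which is defined for all $t\in\mathbb{R}$ and which is affine linear in the sense that $$\sigma(t)=\sigma_0+t\,d\hat\rho_0,\qquad \rho(t)=\rho_0+t\,d\omega_0\qquad\text{for all }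 t\in\mathbb{R}.$$ Moreover, it is the solution: every solution of the Hitchin flow with this initial value at $t=0$ on an interval $I\ni 0$ is its restriction to $I$. -/

import Mathlib

noncomputable section

namespace HitchinFlow

/-! ### Exterior algebra and the Chevalley–Eilenberg differential -/

section Generic

variable {V : Type*} [AddCommGroup V] [Module ℝ V]

/-- The wedge product of real-valued alternating forms, normalised as a sum over shuffles:
`(α ∧ β)(x, y) = α x * β y - α y * β x` for one-forms. -/
def wedge {p q : ℕ} (α : V [⋀^Fin p]→ₗ[ℝ] ℝ) (β : V [⋀^Fin q]→ₗ[ℝ] ℝ) :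
    V [⋀^Fin (p + q)]→ₗ[ℝ] ℝ :=
  ((LinearMap.mul' ℝ ℝ).compAlternatingMap (α.domCoprod β)).domDomCongr finSumFinEquiv

theorem wedge_add_left {p q : ℕ} (α α' : V [⋀^Fin p]→ₗ[ℝ] ℝ) (β : V [⋀^Fin q]→ₗ[ℝ] ℝ) :
    wedge (α + α') β = wedge α β + wedge α' β := by
  ext v
  simp only [wedge, ← AlternatingMap.domCoprod'_apply, TensorProduct.add_tmul, map_add]
  simp

theorem wedge_smul_left {p q : ℕ} (c : ℝ) (α : V [⋀^Fin p]→ₗ[ℝ] ℝ)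
    (β : V [⋀^Fin q]→ₗ[ℝ] ℝ) : wedge (c • α) β = c • wedge α β := by
  ext v
  simp only [wedge, ← AlternatingMap.domCoprod'_apply, ← TensorProduct.smul_tmul', map_smul]
  simp

/-- The set of forms `g^* α`, `g ∈ GL(V)`. -/
def orbit {k : ℕ} (α : V [⋀^Fin k]→ₗ[ℝ] ℝ) : Set (V [⋀^Fin k]→ₗ[ℝ] ℝ) :=
  {β | ∃ g : V ≃ₗ[ℝ] V, β = α.compLinearMap (g : V →ₗ[ℝ] V)}

/-- The topology of pointwise convergence on the space of `k`-forms; for finite-dimensional `V` it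
is the usual vector space topology. -/
abbrev formTopology (V : Type*) [AddCommGroup V] [Module ℝ V] (k : ℕ) :
    TopologicalSpace (V [⋀^Fin k]→ₗ[ℝ] ℝ) :=
  TopologicalSpace.induced (fun β : V [⋀^Fin k]→ₗ[ℝ] ℝ => (β : (Fin k → V) → ℝ))
    Pi.topologicalSpace

/-- A form is stable if its `GL(V)`-orbit is open. -/
def IsStable {k : ℕ} (α : V [⋀^Fin k]→ₗ[ℝ] ℝ) : Prop :=
  @IsOpen _ (formTopology V k) (orbit α)

end Generic

section Differential

variable {L : Type*} [LieRing L] [LieAlgebra ℝ L]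

/-- The exterior derivative of left-invariant forms (Chevalley–Eilenberg differential); see
`d_apply` for the explicit formula. -/
def d {n : ℕ} (α : L [⋀^Fin (n + 1)]→ₗ[ℝ] ℝ) : L [⋀^Fin (n + 2)]→ₗ[ℝ] ℝ :=
  (-(1 / 2 : ℝ)) • AlternatingMap.alternatizeUncurryFin
    (AlternatingMap.alternatizeUncurryFinLM ∘ₗ
      ((LieModule.toEnd ℝ L L : L →ₗ[ℝ] L →ₗ[ℝ] L).compr₂ α.curryLeft))

/-- `dα(v₀, …, vₙ₊₁) = ∑_{i < j} (-1)^(i+j) α([vᵢ, vⱼ], v₀, …, v̂ᵢ, …, v̂ⱼ, …, vₙ₊₁)`, the pairs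
`i < j` being written as `(i.castSucc, j.succ)` with `i ≤ j`. -/
theorem d_apply {n : ℕ} (α : L [⋀^Fin (n + 1)]→ₗ[ℝ] ℝ) (v : Fin (n + 2) → L) :
    d α v = ∑ i : Fin (n + 1), ∑ j ≥ i, (-1 : ℝ) ^ (i + (j + 1) : ℕ) *
      α (Matrix.vecCons ⁅v i.castSucc, v j.succ⁆ (j.removeNth (i.castSucc.removeNth v))) := by
  rw [d, AlternatingMap.smul_apply,
    AlternatingMap.alternatizeUncurryFin_alternatizeUncurryFinLM_comp_apply, Finset.smul_sum]
  refine Finset.sum_congr rfl fun i _ => ?_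
  rw [Finset.smul_sum]
  refine Finset.sum_congr rfl fun j _ => ?_
  have h : α.curryLeft ⁅v j.succ, v i.castSucc⁆ = -α.curryLeft ⁅v i.castSucc, v j.succ⁆ := by
    rw [← lie_skew, map_neg]
  simp only [LinearMap.compr₂_apply, LieHom.coe_toLinearMap, LieModule.toEnd_apply_apply, h]
  simp [pow_add]
  ring

end Differential

/-! ### The Lie algebra `𝔥₃ ⊕ 𝔥₃` -/

/-- The three-dimensional real Heisenberg algebra `𝔥₃`. -/
def Heisenberg : Type := Fin 3 → ℝ

namespace Heisenberg

instance : AddCommGroup Heisenberg := inferInstanceAs (AddCommGroup (Fin 3 → ℝ))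

instance : Module ℝ Heisenberg := inferInstanceAs (Module ℝ (Fin 3 → ℝ))

/-- The only non-trivial bracket of basis vectors is `[e₁, e₂] = -[e₂, e₁] = e₃`. -/
instance : Bracket Heisenberg Heisenberg where
  bracket x y := (![0, 0, x 0 * y 1 - x 1 * y 0] : Fin 3 → ℝ)

theorem bracket_zero (x y : Heisenberg) : ⁅x, y⁆ 0 = 0 := rfl

theorem bracket_one (x y : Heisenberg) : ⁅x, y⁆ 1 = 0 := rfl

theorem bracket_two (x y : Heisenberg) : ⁅x, y⁆ 2 = x 0 * y 1 - x 1 * y 0 := rfl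

@[ext] theorem ext {x y : Heisenberg} (h0 : x 0 = y 0) (h1 : x 1 = y 1) (h2 : x 2 = y 2) :
    x = y := by
  funext i
  fin_cases i
  exacts [h0, h1, h2]

theorem add_apply (x y : Heisenberg) (i : Fin 3) : (x + y) i = x i + y i := rfl

theorem smul_apply (c : ℝ) (x : Heisenberg) (i : Fin 3) : (c • x) i = c * x i := rfl

theorem zero_apply (i : Fin 3) : (0 : Heisenberg) i = 0 := rfl

instance : LieRing Heisenberg where
  add_lie x y z := by
    ext <;> simp only [bracket_zero, bracket_one, bracket_two, add_apply] <;> ring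
  lie_add x y z := by
    ext <;> simp only [bracket_zero, bracket_one, bracket_two, add_apply] <;> ring
  lie_self x := by
    ext <;> simp only [bracket_zero, bracket_one, bracket_two, zero_apply] ; ring
  leibniz_lie x y z := by
    ext <;> simp only [bracket_zero, bracket_one, bracket_two, add_apply] <;> ring

instance : LieAlgebra ℝ Heisenberg where
  lie_smul c x y := by
    ext <;> simp only [bracket_zero, bracket_one, bracket_two, smul_apply] <;> ring

/-- The standard basis of `𝔥₃`. -/
def basis : Module.Basis (Fin 3) ℝ Heisenberg :=
  Module.Basis.ofEquivFun (LinearEquiv.refl ℝ (Fin 3 → ℝ))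

end Heisenberg

/-- The six-dimensional Lie algebra `𝔥₃ ⊕ 𝔥₃`. -/
abbrev H3H3 : Type := Heisenberg × Heisenberg

/-- The space `Λᵏ 𝔤*` of `k`-forms on `𝔤 = 𝔥₃ ⊕ 𝔥₃`. -/
abbrev Form (k : ℕ) : Type := H3H3 [⋀^Fin k]→ₗ[ℝ] ℝ

/-- The basis `(e₁, e₂, e₃, f₁, f₂, f₃)` of `𝔥₃ ⊕ 𝔥₃`. -/
def basis : Module.Basis (Fin 6) ℝ H3H3 :=
  (Heisenberg.basis.prod Heisenberg.basis).reindex finSumFinEquiv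

/-! ### Stable three-forms and their duals -/

/-- For a volume form `ν` and a five-form `β`, the vector `w` with `w ⌟ ν = β`, written in
coordinates; see `curryLeft_vectorOf`. -/
def vectorOf (ν : Form 6) (β : Form 5) : H3H3 :=
  ∑ i : Fin 6, ((-1 : ℝ) ^ (i : ℕ) * β (fun j => basis (i.succAbove j)) / ν basis) • basis i

theorem vectorOf_add (ν : Form 6) (β γ : Form 5) :
    vectorOf ν (β + γ) = vectorOf ν β + vectorOf ν γ := by
  simp only [vectorOf, AlternatingMap.add_apply, mul_add, add_div, add_smul,
    Finset.sum_add_distrib]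

theorem vectorOf_smul (ν : Form 6) (c : ℝ) (β : Form 5) :
    vectorOf ν (c • β) = c • vectorOf ν β := by
  simp only [vectorOf, AlternatingMap.smul_apply, smul_eq_mul, Finset.smul_sum, smul_smul]
  refine Finset.sum_congr rfl fun i _ => ?_
  congr 1
  ring

theorem curryLeft_vectorOf {ν : Form 6} (hν : ν ≠ 0) (β : Form 5) :
    ν.curryLeft (vectorOf ν β) = β := by
  have hb : ν basis ≠ 0 := by
    intro h
    apply hν
    rw [AlternatingMap.eq_smul_basis_det basis ν, h, zero_smul]
  refine Module.Basis.ext_alternating basis fun u hu => ?_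
  obtain ⟨k, hk⟩ : ∃ k : Fin 6, ∀ j, u j ≠ k := by
    by_contra! h
    have := Fintype.card_le_of_surjective u h
    simp at this
  choose τ hτ using fun j => Fin.exists_succAbove_eq (hk j)
  have hτi : Function.Injective τ := fun a b hab => hu (by rw [← hτ a, ← hτ b, hab])
  let σ : Equiv.Perm (Fin 5) := Equiv.ofBijective τ (Finite.injective_iff_bijective.mp hτi)
  have key : ν.curryLeft (vectorOf ν β)
      (fun j => basis (k.succAbove j)) = β (fun j => basis (k.succAbove j)) := by
    have h0 : ∀ i : Fin 6, ν.curryLeft (basis i) (fun j => basis (k.succAbove j)) =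
        if i = k then (-1 : ℝ) ^ (k : ℕ) * ν basis else 0 := by
      intro i
      split_ifs with h
      · subst h
        have h1 := AlternatingMap.neg_one_pow_smul_map_insertNth ν i (basis i)
          (fun j => basis (i.succAbove j))
        have h2 : i.insertNth (basis i) (fun j => basis (i.succAbove j)) = (basis : Fin 6 → H3H3) :=
          Fin.insertNth_self_removeNth i basis
        rw [h2] at h1
        rw [AlternatingMap.curryLeft_apply_apply, ← h1]
        simp
      · obtain ⟨j, hj⟩ := Fin.exists_succAbove_eq h
        rw [AlternatingMap.curryLeft_apply_apply]
        refine AlternatingMap.map_eq_zero_of_eq ν _ (i := 0) (j := j.succ) ?_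
          (Fin.succ_ne_zero j).symm
        simp [hj]
    have h3 : ((-1 : ℝ) ^ (k : ℕ)) * (-1 : ℝ) ^ (k : ℕ) = 1 := by
      rw [← mul_pow]; simp
    have hsum : ∀ (f : Fin 6 → Form 5) (w : Fin 5 → H3H3), (∑ i, f i) w = ∑ i, f i w :=
      fun f w => by simp [Fin.sum_univ_succ]
    simp only [vectorOf, map_sum, map_smul, hsum, AlternatingMap.smul_apply, h0,
      smul_eq_mul, mul_ite, mul_zero, Finset.sum_ite_eq', Finset.mem_univ, if_true]
    field_simp
    linear_combination (β fun j => basis (k.succAbove j)) * h3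
  have hu' : (fun j => basis (u j)) = (fun j => basis (k.succAbove j)) ∘ σ := by
    funext j
    simp [σ, hτ]
  rw [hu', AlternatingMap.map_perm, AlternatingMap.map_perm, key]

/-- The endomorphism `K_ρ` with respect to a volume form `ν`: `K_ρ v` is the vector `w` with
`w ⌟ ν = (v ⌟ ρ) ∧ ρ`. -/
def K (ν : Form 6) (ρ : Form 3) : H3H3 →ₗ[ℝ] H3H3 where
  toFun v := vectorOf ν (wedge (ρ.curryLeft v) ρ)
  map_add' v w := by
    rw [map_add, wedge_add_left]
    exact vectorOf_add ν _ _
  map_smul' c v := by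
    rw [map_smul, wedge_smul_left]
    exact vectorOf_smul ν c _

theorem curryLeft_K {ν : Form 6} (hν : ν ≠ 0) (ρ : Form 3) (v : H3H3) :
    ν.curryLeft (K ν ρ v) = (wedge (ρ.curryLeft v) ρ : Form 5) := by
  rw [K]
  exact curryLeft_vectorOf hν _

/-- The quartic invariant `λ(ρ) = tr (K_ρ²) / 6` with respect to a volume form `ν`. -/
def quartic (ν : Form 6) (ρ : Form 3) : ℝ :=
  LinearMap.trace ℝ H3H3 (K ν ρ ∘ₗ K ν ρ) / 6

/-- The (para-)complex structure `J_ρ = K_ρ / √|λ(ρ)|` of a stable three-form, for the orientation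
given by the volume form `ν`. A positive rescaling of `ν` does not change it. -/
def J (ν : Form 6) (ρ : Form 3) : H3H3 →ₗ[ℝ] H3H3 :=
  (√|quartic ν ρ|)⁻¹ • K ν ρ

/-- `ω ∧ ω ∧ ω`. -/
def cube (ω : Form 2) : Form 6 := wedge (wedge ω ω) ω

/-- The Liouville volume form `φ(ω) = ω³ / 6`, which fixes the orientation. -/
def liouville (ω : Form 2) : Form 6 := (1 / 6 : ℝ) • cube ω

/-- `σ = ω² / 2`. -/
def sigma (ω : Form 2) : Form 4 := (1 / 2 : ℝ) • wedge ω ω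

/-- The dual three-form `ρ̂ = J_ρ^* ρ`, for the orientation given by `φ(ω)`. -/
def dual (ω : Form 2) (ρ : Form 3) : Form 3 :=
  ρ.compLinearMap (J (liouville ω) ρ)

/-- Pairs `(ω, ρ)` defining an `SU(3)`-, `SU(1,2)`- or `SL(3,ℝ)`-structure on `𝔥₃ ⊕ 𝔥₃`; the
structure is not required to be normalised, which would be `c = 2`. -/
structure IsHStructure (ω : Form 2) (ρ : Form 3) : Prop where
  stable_two : IsStable ω
  stable_three : IsStable ρ
  compatible : (wedge ω ρ : Form 5) = 0
  volume : ∃ c : ℝ, 0 < c ∧ (wedge (dual ω ρ) ρ : Form 6) = (c / 3) • cube ω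

/-- Half-flat structures on `𝔥₃ ⊕ 𝔥₃`. -/
structure IsHalfFlat (ω : Form 2) (ρ : Form 3) : Prop extends IsHStructure ω ρ where
  closed_three : d ρ = 0
  closed_four : d (sigma ω) = 0

/-- `(ω, ρ)` is a one-parameter family of stable forms, with parameter in `I`, that solves the
Hitchin flow equations `ρ' = dω`, `σ' = dρ̂` with `σ = ω² / 2`. As the spaces of forms are
finite-dimensional, derivatives are taken after evaluation on arbitrary vectors `v`. -/
structure IsHitchinFlow (I : Set ℝ) (ω : ℝ → Form 2) (ρ : ℝ → Form 3) : Prop where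
  stable_two : ∀ t ∈ I, IsStable (ω t)
  stable_three : ∀ t ∈ I, IsStable (ρ t)
  differentiable : ∀ v, DifferentiableOn ℝ (fun s => ω s v) I
  deriv_three : ∀ t ∈ I, ∀ v, HasDerivWithinAt (fun s => ρ s v) (d (ω t) v) I t
  deriv_four : ∀ t ∈ I, ∀ v,
    HasDerivWithinAt (fun s => sigma (ω s) v) (d (dual (ω t) (ρ t)) v) I t

end HitchinFlow

end

noncomputable section

namespace HitchinFlow

open LieAlgebra

/-! The affine path never leaves the orbit of the initial data under a group that leaves the
right-hand sides of the flow unchanged. Call a form horizontal if contraction with the centre `𝔷`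
kills it. Call a linear automorphism central if it has determinant one and is the identity on `𝔷`
and on `𝔤/𝔷`. The bracket factors through `𝔤/𝔷` and takes values in `𝔷`, so central automorphisms
respect the bracket. Hence pullback by them commutes with `d`, and it fixes horizontal forms and
volume forms.

Isotropy of `𝔷` for `ω₀` makes `dω₀` horizontal. Closedness of `ρ₀` forces `ρ₀(𝔷, 𝔷, ·) = 0`, which
`K_ρ` passes on to `ρ̂₀`, so `dρ̂₀` is horizontal too. Two facts in the four-dimensional quotient
`𝔤/𝔷` then carry the argument. Since `λ(ρ₀) ≠ 0`, some central `m` makes `m ⌟ ρ₀` symplectic on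
`𝔤/𝔷`, and wedging with it maps one-forms onto three-forms; thus `ρ₀ + D` is a central pullback of
`ρ₀` for every horizontal `D` (`CenterIsotropic.exists_central`). Horizontal four-forms form a line,
and a one-parameter family of central shears of `ω₀` sweeps out `σ₀` plus that line
(`IsShear.sigma_eq`). Along the affine path, therefore, `dω` and `dρ̂` keep their initial values
(`CenterIsotropic.d_dual_eq`), and the flow equations hold.

For uniqueness, the flow preserves `ρ(𝔷, 𝔷, ·) = 0`, so `σ(t) - σ(0)` is horizontal and `ω(t)` is a
shear of `ω₀` up to sign. Continuity fixes the sign (`IsHitchinFlow.eq_shear`). Both right-hand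
sides are then constant, and the solution is affine. -/

open Equiv in
/-- The wedge product as a sum over any system of representatives of the shuffles. -/
theorem wedge_apply_eq_sum {V : Type*} [AddCommGroup V] [Module ℝ V] {p q N : ℕ}
    (σ : Fin N → Perm (Fin (p + q)))
    (hσ : ∀ i j, (∀ x : Fin p, ∃ y : Fin p, σ i (Fin.castAdd q x) = σ j (Fin.castAdd q y)) → i = j)
    (hN : N * (p.factorial * q.factorial) = (p + q).factorial)
    (α : V [⋀^Fin p]→ₗ[ℝ] ℝ) (β : V [⋀^Fin q]→ₗ[ℝ] ℝ) (v : Fin (p + q) → V) :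
    wedge α β v = ∑ i, ((Perm.sign (σ i) : ℤ) : ℝ) *
      (α (fun x => v (σ i (Fin.castAdd q x))) * β (fun y => v (σ i (Fin.natAdd p y)))) := by
  let τ : Fin N → Perm (Fin p ⊕ Fin q) := fun i => finSumFinEquiv.symm.permCongr (σ i)
  let m : Fin N → Perm.ModSumCongr (Fin p) (Fin q) := fun i => Quotient.mk'' (τ i)
  have hm : Function.Injective m := by
    intro i j hij
    obtain ⟨⟨sl, sr⟩, h⟩ := QuotientGroup.leftRel_apply.mp (Quotient.exact' hij)
    refine (hσ j i fun x => ⟨sl x, ?_⟩).symm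
    have h1 := congrArg (fun e : Perm _ => τ i (e (Sum.inl x))) h
    simp only [Perm.sumCongrHom_apply, Perm.sumCongr_apply, Sum.map_inl, Perm.mul_apply,
      Perm.inv_def, Equiv.apply_symm_apply] at h1
    have h2 := congrArg finSumFinEquiv h1
    simpa [τ, Equiv.permCongr_apply] using h2.symm
  have hcard : Fintype.card (Fin N) = Fintype.card (Perm.ModSumCongr (Fin p) (Fin q)) := by
    have h1 := Subgroup.card_eq_card_quotient_mul_card_subgroup
      (Perm.sumCongrHom (Fin p) (Fin q)).range
    rw [Nat.card_congr (MonoidHom.ofInjective Perm.sumCongrHom_injective).toEquiv.symm] at h1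
    simp only [Nat.card_eq_fintype_card, Fintype.card_prod, Fintype.card_perm, Fintype.card_sum,
      Fintype.card_fin, ← hN] at h1
    simpa using Nat.eq_of_mul_eq_mul_right (by positivity) h1
  have hb : Function.Bijective m := (Fintype.bijective_iff_injective_and_card m).2 ⟨hm, hcard⟩
  have hs : ∀ i, Perm.sign (τ i) = Perm.sign (σ i) := fun i => Perm.sign_permCongr _ _
  have key : wedge α β v = LinearMap.mul' ℝ ℝ (∑ s : Perm.ModSumCongr (Fin p) (Fin q),
      AlternatingMap.domCoprod.summand α β s (v ∘ finSumFinEquiv)) := by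
    simp only [wedge, AlternatingMap.domDomCongr_apply, LinearMap.compAlternatingMap_apply,
      AlternatingMap.domCoprod_apply, sum_apply]
  rw [key, ← hb.sum_comp, map_sum]
  refine Finset.sum_congr rfl fun i _ => ?_
  simp only [m, AlternatingMap.domCoprod.summand_mk'', hs]
  rw [smul_apply, MultilinearMap.domDomCongr_apply, MultilinearMap.domCoprod_apply]
  rcases Int.units_eq_one_or (Perm.sign (σ i)) with h | h <;>
    simp [h, τ, Equiv.permCongr_apply]

/-! ### Explicit wedge products in low degree -/

/-- The `(2, 2)`-shuffles. -/
def shuffleTwoTwo : Fin 6 → Equiv.Perm (Fin 4) := ![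
  ⟨![0, 1, 2, 3], ![0, 1, 2, 3], by decide, by decide⟩,
  ⟨![0, 2, 1, 3], ![0, 2, 1, 3], by decide, by decide⟩,
  ⟨![0, 3, 1, 2], ![0, 2, 3, 1], by decide, by decide⟩,
  ⟨![1, 2, 0, 3], ![2, 0, 1, 3], by decide, by decide⟩,
  ⟨![1, 3, 0, 2], ![2, 0, 3, 1], by decide, by decide⟩,
  ⟨![2, 3, 0, 1], ![2, 3, 0, 1], by decide, by decide⟩]

theorem sign_shuffleTwoTwo (i : Fin 6) : Equiv.Perm.sign (shuffleTwoTwo i) =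
    ![1, -1, 1, 1, -1, 1] i := by
  revert i
  decide

/-- The `(2, 3)`-shuffles. -/
def shuffleTwoThree : Fin 10 → Equiv.Perm (Fin 5) := ![
  ⟨![0, 1, 2, 3, 4], ![0, 1, 2, 3, 4], by decide, by decide⟩,
  ⟨![0, 2, 1, 3, 4], ![0, 2, 1, 3, 4], by decide, by decide⟩,
  ⟨![0, 3, 1, 2, 4], ![0, 2, 3, 1, 4], by decide, by decide⟩,
  ⟨![0, 4, 1, 2, 3], ![0, 2, 3, 4, 1], by decide, by decide⟩,
  ⟨![1, 2, 0, 3, 4], ![2, 0, 1, 3, 4], by decide, by decide⟩,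
  ⟨![1, 3, 0, 2, 4], ![2, 0, 3, 1, 4], by decide, by decide⟩,
  ⟨![1, 4, 0, 2, 3], ![2, 0, 3, 4, 1], by decide, by decide⟩,
  ⟨![2, 3, 0, 1, 4], ![2, 3, 0, 1, 4], by decide, by decide⟩,
  ⟨![2, 4, 0, 1, 3], ![2, 3, 0, 4, 1], by decide, by decide⟩,
  ⟨![3, 4, 0, 1, 2], ![2, 3, 4, 0, 1], by decide, by decide⟩]

theorem sign_shuffleTwoThree (i : Fin 10) : Equiv.Perm.sign (shuffleTwoThree i) =
    ![1, -1, 1, -1, 1, -1, 1, 1, -1, 1] i := by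
  revert i
  decide

/-- The `(4, 2)`-shuffles. -/
def shuffleFourTwo : Fin 15 → Equiv.Perm (Fin 6) := ![
  ⟨![0, 1, 2, 3, 4, 5], ![0, 1, 2, 3, 4, 5], by decide, by decide⟩,
  ⟨![0, 1, 2, 4, 3, 5], ![0, 1, 2, 4, 3, 5], by decide, by decide⟩,
  ⟨![0, 1, 2, 5, 3, 4], ![0, 1, 2, 4, 5, 3], by decide, by decide⟩,
  ⟨![0, 1, 3, 4, 2, 5], ![0, 1, 4, 2, 3, 5], by decide, by decide⟩,
  ⟨![0, 1, 3, 5, 2, 4], ![0, 1, 4, 2, 5, 3], by decide, by decide⟩,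
  ⟨![0, 1, 4, 5, 2, 3], ![0, 1, 4, 5, 2, 3], by decide, by decide⟩,
  ⟨![0, 2, 3, 4, 1, 5], ![0, 4, 1, 2, 3, 5], by decide, by decide⟩,
  ⟨![0, 2, 3, 5, 1, 4], ![0, 4, 1, 2, 5, 3], by decide, by decide⟩,
  ⟨![0, 2, 4, 5, 1, 3], ![0, 4, 1, 5, 2, 3], by decide, by decide⟩,
  ⟨![0, 3, 4, 5, 1, 2], ![0, 4, 5, 1, 2, 3], by decide, by decide⟩,
  ⟨![1, 2, 3, 4, 0, 5], ![4, 0, 1, 2, 3, 5], by decide, by decide⟩,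
  ⟨![1, 2, 3, 5, 0, 4], ![4, 0, 1, 2, 5, 3], by decide, by decide⟩,
  ⟨![1, 2, 4, 5, 0, 3], ![4, 0, 1, 5, 2, 3], by decide, by decide⟩,
  ⟨![1, 3, 4, 5, 0, 2], ![4, 0, 5, 1, 2, 3], by decide, by decide⟩,
  ⟨![2, 3, 4, 5, 0, 1], ![4, 5, 0, 1, 2, 3], by decide, by decide⟩]

theorem sign_shuffleFourTwo (i : Fin 15) : Equiv.Perm.sign (shuffleFourTwo i) =
    ![1, -1, 1, 1, -1, 1, -1, 1, -1, 1, 1, -1, 1, -1, 1] i := by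
  revert i
  decide

theorem wedge_two_two {V : Type*} [AddCommGroup V] [Module ℝ V]
    (α : V [⋀^Fin 2]→ₗ[ℝ] ℝ) (β : V [⋀^Fin 2]→ₗ[ℝ] ℝ) (v : Fin 4 → V) : wedge α β v =
      α ![v 0, v 1] * β ![v 2, v 3] - α ![v 0, v 2] * β ![v 1, v 3] +
      α ![v 0, v 3] * β ![v 1, v 2] + α ![v 1, v 2] * β ![v 0, v 3] -
      α ![v 1, v 3] * β ![v 0, v 2] + α ![v 2, v 3] * β ![v 0, v 1] := by
  have h : wedge α β v = ∑ i, (((![1, -1, 1, 1, -1, 1] :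
      Fin 6 → ℤˣ) i : ℤ) : ℝ) *
      (α ![v (shuffleTwoTwo i 0), v (shuffleTwoTwo i 1)] *
        β ![v (shuffleTwoTwo i 2), v (shuffleTwoTwo i 3)]) := by
    rw [wedge_apply_eq_sum shuffleTwoTwo (by decide) (by decide)]
    refine Finset.sum_congr rfl fun i _ => ?_
    congr 1
    · exact congrArg (fun s : ℤˣ => ((s : ℤ) : ℝ)) (sign_shuffleTwoTwo i)
    · congr 2 <;> ext x <;> fin_cases x <;> rfl
  rw [h]
  simp [Fin.sum_univ_succ, shuffleTwoTwo]
  ring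

theorem wedge_two_three {V : Type*} [AddCommGroup V] [Module ℝ V]
    (α : V [⋀^Fin 2]→ₗ[ℝ] ℝ) (β : V [⋀^Fin 3]→ₗ[ℝ] ℝ) (v : Fin 5 → V) : wedge α β v =
      α ![v 0, v 1] * β ![v 2, v 3, v 4] - α ![v 0, v 2] * β ![v 1, v 3, v 4] +
      α ![v 0, v 3] * β ![v 1, v 2, v 4] - α ![v 0, v 4] * β ![v 1, v 2, v 3] +
      α ![v 1, v 2] * β ![v 0, v 3, v 4] - α ![v 1, v 3] * β ![v 0, v 2, v 4] +
      α ![v 1, v 4] * β ![v 0, v 2, v 3] + α ![v 2, v 3] * β ![v 0, v 1, v 4] -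
      α ![v 2, v 4] * β ![v 0, v 1, v 3] + α ![v 3, v 4] * β ![v 0, v 1, v 2] := by
  have h : wedge α β v = ∑ i, (((![1, -1, 1, -1, 1, -1, 1, 1, -1, 1] :
      Fin 10 → ℤˣ) i : ℤ) : ℝ) *
      (α ![v (shuffleTwoThree i 0), v (shuffleTwoThree i 1)] *
        β ![v (shuffleTwoThree i 2), v (shuffleTwoThree i 3), v (shuffleTwoThree i 4)]) := by
    rw [wedge_apply_eq_sum shuffleTwoThree (by decide) (by decide)]
    refine Finset.sum_congr rfl fun i _ => ?_
    congr 1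
    · exact congrArg (fun s : ℤˣ => ((s : ℤ) : ℝ)) (sign_shuffleTwoThree i)
    · congr 2 <;> ext x <;> fin_cases x <;> rfl
  rw [h]
  simp [Fin.sum_univ_succ, shuffleTwoThree]
  ring

theorem wedge_four_two {V : Type*} [AddCommGroup V] [Module ℝ V]
    (α : V [⋀^Fin 4]→ₗ[ℝ] ℝ) (β : V [⋀^Fin 2]→ₗ[ℝ] ℝ) (v : Fin 6 → V) : wedge α β v =
      α ![v 0, v 1, v 2, v 3] * β ![v 4, v 5] - α ![v 0, v 1, v 2, v 4] * β ![v 3, v 5] +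
      α ![v 0, v 1, v 2, v 5] * β ![v 3, v 4] + α ![v 0, v 1, v 3, v 4] * β ![v 2, v 5] -
      α ![v 0, v 1, v 3, v 5] * β ![v 2, v 4] + α ![v 0, v 1, v 4, v 5] * β ![v 2, v 3] -
      α ![v 0, v 2, v 3, v 4] * β ![v 1, v 5] + α ![v 0, v 2, v 3, v 5] * β ![v 1, v 4] -
      α ![v 0, v 2, v 4, v 5] * β ![v 1, v 3] + α ![v 0, v 3, v 4, v 5] * β ![v 1, v 2] +
      α ![v 1, v 2, v 3, v 4] * β ![v 0, v 5] - α ![v 1, v 2, v 3, v 5] * β ![v 0, v 4] +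
      α ![v 1, v 2, v 4, v 5] * β ![v 0, v 3] - α ![v 1, v 3, v 4, v 5] * β ![v 0, v 2] +
      α ![v 2, v 3, v 4, v 5] * β ![v 0, v 1] := by
  have h : wedge α β v = ∑ i, (((![1, -1, 1, 1, -1, 1, -1, 1, -1, 1, 1, -1, 1, -1, 1] :
      Fin 15 → ℤˣ) i : ℤ) : ℝ) *
      (α ![v (shuffleFourTwo i 0), v (shuffleFourTwo i 1), v (shuffleFourTwo i 2),
          v (shuffleFourTwo i 3)] *
        β ![v (shuffleFourTwo i 4), v (shuffleFourTwo i 5)]) := by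
    rw [wedge_apply_eq_sum shuffleFourTwo (by decide) (by decide)]
    refine Finset.sum_congr rfl fun i _ => ?_
    congr 1
    · exact congrArg (fun s : ℤˣ => ((s : ℤ) : ℝ)) (sign_shuffleFourTwo i)
    · congr 2 <;> ext x <;> fin_cases x <;> rfl
  rw [h]
  simp [Fin.sum_univ_succ, shuffleFourTwo]
  ring

/-! ### Pullback of forms, orbits and volume forms -/

section Naturality

variable {V : Type*} [AddCommGroup V] [Module ℝ V]

theorem wedge_compLinearMap {p q : ℕ} (α : V [⋀^Fin p]→ₗ[ℝ] ℝ) (β : V [⋀^Fin q]→ₗ[ℝ] ℝ)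
    (g : V →ₗ[ℝ] V) :
    wedge (α.compLinearMap g) (β.compLinearMap g) = (wedge α β).compLinearMap g := by
  ext v
  simp only [wedge, AlternatingMap.domDomCongr_apply, LinearMap.compAlternatingMap_apply,
    AlternatingMap.domCoprod_apply, sum_apply, AlternatingMap.compLinearMap_apply]
  refine congrArg _ (Finset.sum_congr rfl fun s _ => ?_)
  induction s using Quotient.inductionOn' with | _ s
  simp only [AlternatingMap.domCoprod.summand_mk'', smul_apply,
    MultilinearMap.domDomCongr_apply, MultilinearMap.domCoprod_apply]
  rfl

theorem orbit_compLinearMap {k : ℕ} (α : V [⋀^Fin k]→ₗ[ℝ] ℝ) (g : V ≃ₗ[ℝ] V) :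
    orbit (α.compLinearMap (g : V →ₗ[ℝ] V)) = orbit α := by
  ext β
  constructor
  · rintro ⟨h, rfl⟩
    exact ⟨h.trans g, by ext v; rfl⟩
  · rintro ⟨h, rfl⟩
    exact ⟨h.trans g.symm, by
      ext v
      simp only [AlternatingMap.compLinearMap_apply]
      congr 1
      ext i
      simp⟩

theorem IsStable.compLinearMap {k : ℕ} {α : V [⋀^Fin k]→ₗ[ℝ] ℝ} (h : IsStable α)
    (g : V ≃ₗ[ℝ] V) : IsStable (α.compLinearMap (g : V →ₗ[ℝ] V)) := by
  rw [IsStable, orbit_compLinearMap]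
  exact h

theorem compLinearMap_eq_of_det_eq_one {n : ℕ} (b : Module.Basis (Fin n) ℝ V)
    (ν : V [⋀^Fin n]→ₗ[ℝ] ℝ) (g : V →ₗ[ℝ] V) (hg : LinearMap.det g = 1) :
    ν.compLinearMap g = ν := by
  rw [ν.eq_smul_basis_det b]
  ext v
  have := b.det_comp g v
  simp only [AlternatingMap.compLinearMap_apply, AlternatingMap.smul_apply]
  rw [show (fun i => g (v i)) = g ∘ v from rfl, this, hg, one_mul]

/-- Alternating forms are determined by their values on increasing families of basis vectors. -/
theorem ext_alternating_of_strictMono {n k : ℕ} (b : Module.Basis (Fin n) ℝ V)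
    {α β : V [⋀^Fin k]→ₗ[ℝ] ℝ}
    (h : ∀ u : Fin k → Fin n, StrictMono u → α (b ∘ u) = β (b ∘ u)) : α = β := by
  refine Module.Basis.ext_alternating b fun u hu => ?_
  have h1 : StrictMono (u ∘ Tuple.sort u) :=
    (Tuple.monotone_sort u).strictMono_of_injective (hu.comp (Tuple.sort u).injective)
  have h2 := h _ h1
  rw [← Function.comp_assoc, AlternatingMap.map_perm, AlternatingMap.map_perm] at h2
  exact smul_left_cancel _ h2

end Naturality

/-! ### The differential: naturality and explicit formulas -/

section Differential

variable {L : Type*} [LieRing L] [LieAlgebra ℝ L]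

theorem d_compLinearMap {n : ℕ} (α : L [⋀^Fin (n + 1)]→ₗ[ℝ] ℝ) (g : L →ₗ[ℝ] L)
    (hg : ∀ x y, g ⁅x, y⁆ = ⁅g x, g y⁆) :
    d (α.compLinearMap g) = (d α).compLinearMap g := by
  ext v
  rw [AlternatingMap.compLinearMap_apply, d_apply, d_apply]
  refine Finset.sum_congr rfl fun i _ => Finset.sum_congr rfl fun j _ => ?_
  rw [AlternatingMap.compLinearMap_apply]
  congr 2
  ext k
  refine Fin.cases ?_ (fun k => ?_) k
  · simp [hg]
  · simp [Fin.removeNth]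

theorem d_two (α : L [⋀^Fin 2]→ₗ[ℝ] ℝ) (x y w : L) : d α ![x, y, w] =
    -α ![⁅x, y⁆, w] + α ![⁅x, w⁆, y] - α ![⁅y, w⁆, x] := by
  have h : d α ![x, y, w] = ∑ i : Fin 2, ∑ j : Fin 2, if i ≤ j then (-1 : ℝ) ^ (i + (j + 1) : ℕ) *
      α (Matrix.vecCons ⁅![x, y, w] i.castSucc, ![x, y, w] j.succ⁆
        (j.removeNth (i.castSucc.removeNth ![x, y, w]))) else 0 := by
    rw [d_apply]
    refine Finset.sum_congr rfl fun i _ => ?_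
    rw [← Finset.sum_filter]
    congr 1
    ext j
    simp
  have e2 : (1 : Fin 2).removeNth ![y, w] = ![y] := by
    ext i; fin_cases i; rfl
  have e3 : (1 : Fin 2).removeNth ((1 : Fin 3).removeNth ![x, y, w]) = ![x] := by
    ext i; fin_cases i; rfl
  rw [h]
  simp [Fin.sum_univ_succ, e2, e3]
  ring

theorem d_three (α : L [⋀^Fin 3]→ₗ[ℝ] ℝ) (x y w v : L) : d α ![x, y, w, v] =
    -α ![⁅x, y⁆, w, v] + α ![⁅x, w⁆, y, v] - α ![⁅x, v⁆, y, w] - α ![⁅y, w⁆, x, v] +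
      α ![⁅y, v⁆, x, w] - α ![⁅w, v⁆, x, y] := by
  have h : d α ![x, y, w, v] = ∑ i : Fin 3, ∑ j : Fin 3, if i ≤ j then
      (-1 : ℝ) ^ (i + (j + 1) : ℕ) *
      α (Matrix.vecCons ⁅![x, y, w, v] i.castSucc, ![x, y, w, v] j.succ⁆
        (j.removeNth (i.castSucc.removeNth ![x, y, w, v]))) else 0 := by
    rw [d_apply]
    refine Finset.sum_congr rfl fun i _ => ?_
    rw [← Finset.sum_filter]
    congr 1
    ext j
    simp
  have e2 : (1 : Fin 3).removeNth ![y, w, v] = ![y, v] := by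
    ext i; fin_cases i <;> rfl
  have e3 : (2 : Fin 3).removeNth ![y, w, v] = ![y, w] := by
    ext i; fin_cases i <;> rfl
  have e4 : (1 : Fin 3).removeNth ((1 : Fin 4).removeNth ![x, y, w, v]) = ![x, v] := by
    ext i; fin_cases i <;> rfl
  have e5 : (2 : Fin 3).removeNth ((1 : Fin 4).removeNth ![x, y, w, v]) = ![x, w] := by
    ext i; fin_cases i <;> rfl
  have e6 : (2 : Fin 3).removeNth ((2 : Fin 4).removeNth ![x, y, w, v]) = ![x, y] := by
    ext i; fin_cases i <;> rfl
  rw [h]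
  simp [Fin.sum_univ_succ, e2, e3, e4, e5, e6]
  ring
end Differential

/-! ### Coordinates, bracket and centre of `𝔥₃ ⊕ 𝔥₃` -/

theorem repr_basis (x : H3H3) : (basis.repr x : Fin 6 → ℝ) =
    ![x.1 0, x.1 1, x.1 2, x.2 0, x.2 1, x.2 2] := by
  ext i
  fin_cases i <;> rfl

theorem eq_sum_basis (x : H3H3) : x = x.1 0 • basis 0 + x.1 1 • basis 1 + x.1 2 • basis 2 +
    x.2 0 • basis 3 + x.2 1 • basis 4 + x.2 2 • basis 5 := by
  conv_lhs => rw [← basis.sum_repr x]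
  simp [Fin.sum_univ_succ, repr_basis, add_assoc]

theorem basis_coord (k : Fin 6) :
    ![(basis k).1 0, (basis k).1 1, (basis k).1 2, (basis k).2 0, (basis k).2 1, (basis k).2 2] =
      Pi.single k 1 := by
  rw [← repr_basis, Module.Basis.repr_self, Finsupp.single_eq_pi_single]

theorem ext_coord {x y : H3H3} (h0 : x.1 0 = y.1 0) (h1 : x.1 1 = y.1 1) (h2 : x.1 2 = y.1 2)
    (h3 : x.2 0 = y.2 0) (h4 : x.2 1 = y.2 1) (h5 : x.2 2 = y.2 2) : x = y :=
  Prod.ext (Heisenberg.ext h0 h1 h2) (Heisenberg.ext h3 h4 h5)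

theorem basis_fst_zero (k : Fin 6) : (basis k).1 0 = if k = 0 then 1 else 0 := by
  simpa [Pi.single_apply, eq_comm] using congrFun (basis_coord k) 0

theorem basis_fst_one (k : Fin 6) : (basis k).1 1 = if k = 1 then 1 else 0 := by
  simpa [Pi.single_apply, eq_comm] using congrFun (basis_coord k) 1

theorem basis_fst_two (k : Fin 6) : (basis k).1 2 = if k = 2 then 1 else 0 := by
  simpa [Pi.single_apply, eq_comm] using congrFun (basis_coord k) 2

theorem basis_snd_zero (k : Fin 6) : (basis k).2 0 = if k = 3 then 1 else 0 := by
  simpa [Pi.single_apply, eq_comm] using congrFun (basis_coord k) 3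

theorem basis_snd_one (k : Fin 6) : (basis k).2 1 = if k = 4 then 1 else 0 := by
  simpa [Pi.single_apply, eq_comm] using congrFun (basis_coord k) 4

theorem basis_snd_two (k : Fin 6) : (basis k).2 2 = if k = 5 then 1 else 0 := by
  simpa [Pi.single_apply, eq_comm] using congrFun (basis_coord k) 5

theorem lie_eq (x y : H3H3) : ⁅x, y⁆ = (x.1 0 * y.1 1 - x.1 1 * y.1 0) • basis 2 +
    (x.2 0 * y.2 1 - x.2 1 * y.2 0) • basis 5 := by
  refine ext_coord ?_ ?_ ?_ ?_ ?_ ?_ <;>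
    simp [Heisenberg.add_apply, Heisenberg.smul_apply, basis_fst_zero, basis_fst_one, basis_fst_two,
      basis_snd_zero, basis_snd_one, basis_snd_two, Heisenberg.bracket_zero, Heisenberg.bracket_one,
      Heisenberg.bracket_two]

theorem mem_center_iff {z : H3H3} :
    z ∈ center ℝ H3H3 ↔ z.1 0 = 0 ∧ z.1 1 = 0 ∧ z.2 0 = 0 ∧ z.2 1 = 0 := by
  rw [LieModule.mem_maxTrivSubmodule]
  constructor
  · intro h
    have c1 : ∀ x : H3H3, x.1 0 * z.1 1 - x.1 1 * z.1 0 = 0 := fun x =>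
      congrArg (fun w : H3H3 => w.1 2) (h x)
    have c2 : ∀ x : H3H3, x.2 0 * z.2 1 - x.2 1 * z.2 0 = 0 := fun x =>
      congrArg (fun w : H3H3 => w.2 2) (h x)
    have h0 := c1 (basis 0)
    have h1 := c1 (basis 1)
    have h2 := c2 (basis 3)
    have h3 := c2 (basis 4)
    simp only [basis_fst_zero, basis_fst_one, basis_snd_zero, basis_snd_one] at h0 h1 h2 h3
    simp at h0 h1 h2 h3
    exact ⟨h1, h0, h3, h2⟩
  · rintro ⟨h1, h2, h3, h4⟩ x
    rw [lie_eq]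
    simp [h1, h2, h3, h4]

theorem lie_mem_center (x y : H3H3) : ⁅x, y⁆ ∈ center ℝ H3H3 :=
  mem_center_iff.2 ⟨rfl, rfl, rfl, rfl⟩

theorem exists_of_mem_center {z : H3H3} (hz : z ∈ center ℝ H3H3) :
    ∃ a b : ℝ, z = a • basis 2 + b • basis 5 := by
  obtain ⟨h1, h2, h3, h4⟩ := mem_center_iff.1 hz
  refine ⟨z.1 2, z.2 2, ?_⟩
  conv_lhs => rw [eq_sum_basis z, h1, h2, h3, h4]
  simp

theorem lie_basis_zero_one : ⁅(basis 0 : H3H3), (basis 1 : H3H3)⁆ = basis 2 := by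
  rw [lie_eq]
  simp [basis_fst_zero, basis_fst_one, basis_snd_zero, basis_snd_one]

theorem lie_basis_three_four : ⁅(basis 3 : H3H3), (basis 4 : H3H3)⁆ = basis 5 := by
  rw [lie_eq]
  simp [basis_fst_zero, basis_fst_one, basis_snd_zero, basis_snd_one]

theorem basis_two_mem_center : (basis 2 : H3H3) ∈ center ℝ H3H3 :=
  mem_center_iff.2 (by simp [basis_fst_zero, basis_fst_one, basis_snd_zero, basis_snd_one])

theorem basis_five_mem_center : (basis 5 : H3H3) ∈ center ℝ H3H3 :=
  mem_center_iff.2 (by simp [basis_fst_zero, basis_fst_one, basis_snd_zero, basis_snd_one])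

/-! ### Horizontal forms and central automorphisms -/

/-- Forms annihilated by contraction with the centre. -/
def Horizontal {k : ℕ} (θ : Form k) : Prop :=
  ∀ v : Fin k → H3H3, ∀ i, v i ∈ center ℝ H3H3 → θ v = 0

theorem horizontal_of_cons {k : ℕ} {θ : Form (k + 1)}
    (h : ∀ z ∈ center ℝ H3H3, ∀ v, θ (Matrix.vecCons z v) = 0) : Horizontal θ := by
  intro v i hi
  have h1 := AlternatingMap.map_perm θ v (Equiv.swap 0 i)
  have h2 : θ (v ∘ Equiv.swap 0 i) = 0 := by
    have := h (v i) hi (Matrix.vecTail (v ∘ Equiv.swap 0 i))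
    rw [← this]
    congr 1
    funext j
    refine Fin.cases ?_ (fun j => ?_) j <;> simp [Matrix.vecTail]
  rw [h2] at h1
  exact (smul_eq_zero_iff_eq _).1 h1.symm

/-- Exchange the arguments one at a time: each exchange alters the value by a term with a central
argument, which vanishes. -/
theorem Horizontal.congr {k : ℕ} {θ : Form k} (h : Horizontal θ) {v w : Fin k → H3H3}
    (hvw : ∀ i, v i - w i ∈ center ℝ H3H3) : θ v = θ w := by
  classical
  have key : ∀ s : Finset (Fin k), θ (s.piecewise v w) = θ w := by
    intro s
    induction s using Finset.induction_on with
    | empty => simp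
    | insert i s hi ih =>
      rw [Finset.piecewise_insert, ← ih]
      have h1 : v i = w i + (v i - w i) := by abel
      rw [h1, AlternatingMap.map_update_add,
        h (Function.update (s.piecewise v w) i (v i - w i)) i (by simpa using hvw i), add_zero]
      congr 1
      rw [Function.update_eq_self_iff]
      simp [hi]
  simpa using key Finset.univ

theorem Horizontal.smul {k : ℕ} {θ : Form k} (h : Horizontal θ) (c : ℝ) : Horizontal (c • θ) :=
  fun v i hi => by rw [AlternatingMap.smul_apply, h v i hi, smul_zero]

/-- Linear automorphisms of determinant one that induce the identity on the centre and on the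
quotient by the centre. -/
structure IsCentral (g : H3H3 ≃ₗ[ℝ] H3H3) : Prop where
  sub_mem : ∀ x, g x - x ∈ center ℝ H3H3
  fix : ∀ z ∈ center ℝ H3H3, g z = z
  det : LinearMap.det (g : H3H3 →ₗ[ℝ] H3H3) = 1

/-- The bracket is central, hence fixed by `g`, and it depends only on classes modulo the centre,
which `g` does not move. -/
theorem IsCentral.map_lie {g : H3H3 ≃ₗ[ℝ] H3H3} (hg : IsCentral g) (x y : H3H3) :
    g ⁅x, y⁆ = ⁅g x, g y⁆ := by
  rw [hg.fix _ (lie_mem_center x y), lie_eq x y, lie_eq (g x) (g y)]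
  obtain ⟨a1, a2, a3, a4⟩ := mem_center_iff.1 (hg.sub_mem x)
  obtain ⟨b1, b2, b3, b4⟩ := mem_center_iff.1 (hg.sub_mem y)
  have e1 : ∀ u w : H3H3, ∀ i, (u - w).1 i = u.1 i - w.1 i := fun _ _ _ => rfl
  have e2 : ∀ u w : H3H3, ∀ i, (u - w).2 i = u.2 i - w.2 i := fun _ _ _ => rfl
  simp only [e1, e2, sub_eq_zero] at a1 a2 a3 a4 b1 b2 b3 b4
  simp only [a1, a2, a3, a4, b1, b2, b3, b4]

theorem IsCentral.d_comp {g : H3H3 ≃ₗ[ℝ] H3H3} (hg : IsCentral g) {n : ℕ} (α : Form (n + 1)) :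
    d (α.compLinearMap (g : H3H3 →ₗ[ℝ] H3H3)) =
      (d α).compLinearMap (g : H3H3 →ₗ[ℝ] H3H3) :=
  d_compLinearMap α _ hg.map_lie

theorem Horizontal.comp_central {k : ℕ} {θ : Form k} (h : Horizontal θ) {g : H3H3 ≃ₗ[ℝ] H3H3}
    (hg : IsCentral g) : θ.compLinearMap (g : H3H3 →ₗ[ℝ] H3H3) = θ := by
  ext v
  exact h.congr fun i => hg.sub_mem (v i)

theorem IsCentral.comp_six {g : H3H3 ≃ₗ[ℝ] H3H3} (hg : IsCentral g) (ν : Form 6) :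
    ν.compLinearMap (g : H3H3 →ₗ[ℝ] H3H3) = ν :=
  compLinearMap_eq_of_det_eq_one basis ν _ hg.det

/-- The central automorphism `x ↦ x + ℓ(x) m`. -/
theorem exists_central (ℓ : H3H3 →ₗ[ℝ] ℝ) (m : H3H3) (hℓ : ∀ z ∈ center ℝ H3H3, ℓ z = 0)
    (hm : m ∈ center ℝ H3H3) :
    ∃ g : H3H3 ≃ₗ[ℝ] H3H3, IsCentral g ∧ ∀ x, g x = x + ℓ x • m := by
  -- Since `ℓ m = 0`, the map is a transvection: invertible, of determinant one.
  refine ⟨LinearEquiv.transvection (hℓ m hm), ⟨fun x => ?_, fun z hz => ?_, ?_⟩, fun x => ?_⟩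
  · rw [LinearEquiv.transvection.apply, add_sub_cancel_left]
    exact (center ℝ H3H3).smul_mem _ hm
  · rw [LinearEquiv.transvection.apply, hℓ z hz, zero_smul, add_zero]
  · have := LinearEquiv.transvection.det_eq_one (hℓ m hm)
    rw [← LinearEquiv.coe_det, this, Units.val_one]
  · rw [LinearEquiv.transvection.apply]

/-- The centre is isotropic for a three-form. -/
def CenterIsotropic (ρ : Form 3) : Prop :=
  ∀ z ∈ center ℝ H3H3, ∀ z' ∈ center ℝ H3H3, ∀ x, ρ ![z, z', x] = 0

theorem vec_three_eq (v : Fin 3 → H3H3) : v = ![v 0, v 1, v 2] := by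
  ext i : 1; fin_cases i <;> rfl

theorem vec_two_eq (v : Fin 2 → H3H3) : v = ![v 0, v 1] := by
  ext i : 1; fin_cases i <;> rfl

theorem lie_eq_zero_of_mem_center {z : H3H3} (hz : z ∈ center ℝ H3H3) (x : H3H3) :
    ⁅z, x⁆ = 0 := by
  obtain ⟨h1, h2, h3, h4⟩ := mem_center_iff.1 hz
  rw [lie_eq]
  simp [h1, h2, h3, h4]

/-! ### Multilinear rules for two- and three-forms -/

section Multilinear

variable (ω : Form 2) (ρ : Form 3) (x x' y y' w w' : H3H3) (c : ℝ)

theorem two_add_left : ω ![x + x', y] = ω ![x, y] + ω ![x', y] :=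
  ω.map_vecCons_add _ _ _

theorem two_smul_left : ω ![c • x, y] = c * ω ![x, y] :=
  ω.map_vecCons_smul _ _ _

theorem two_swap : ω ![y, x] = -ω ![x, y] := by
  rw [← ω.map_swap ![x, y] (i := 0) (j := 1) (by decide)]
  congr 1
  funext i
  fin_cases i <;> rfl

theorem two_add_right : ω ![x, y + y'] = ω ![x, y] + ω ![x, y'] := by
  rw [two_swap, two_add_left, two_swap ω x y, two_swap ω x y']
  ring

theorem two_smul_right : ω ![x, c • y] = c * ω ![x, y] := by
  rw [two_swap, two_smul_left, two_swap ω x y]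
  ring

theorem two_zero_left : ω ![0, y] = 0 :=
  ω.map_coord_zero 0 rfl

theorem two_self : ω ![x, x] = 0 :=
  ω.map_eq_zero_of_eq _ (i := 0) (j := 1) rfl (by decide)

theorem three_swap_left : ρ ![y, x, w] = -ρ ![x, y, w] := by
  rw [← ρ.map_swap ![x, y, w] (i := 0) (j := 1) (by decide)]
  congr 1
  funext i
  fin_cases i <;> rfl

theorem three_swap_right : ρ ![x, w, y] = -ρ ![x, y, w] := by
  rw [← ρ.map_swap ![x, y, w] (i := 1) (j := 2) (by decide)]
  congr 1
  funext i
  fin_cases i <;> rfl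

theorem three_add_zero : ρ ![x + x', y, w] = ρ ![x, y, w] + ρ ![x', y, w] :=
  ρ.map_vecCons_add _ _ _

theorem three_smul_zero : ρ ![c • x, y, w] = c * ρ ![x, y, w] :=
  ρ.map_vecCons_smul _ _ _

theorem three_add_one : ρ ![x, y + y', w] = ρ ![x, y, w] + ρ ![x, y', w] := by
  rw [three_swap_left, three_add_zero, three_swap_left ρ x y, three_swap_left ρ x y']
  ring

theorem three_smul_one : ρ ![x, c • y, w] = c * ρ ![x, y, w] := by
  rw [three_swap_left, three_smul_zero, three_swap_left ρ x y]
  ring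

theorem three_add_two : ρ ![x, y, w + w'] = ρ ![x, y, w] + ρ ![x, y, w'] := by
  rw [three_swap_right, three_add_one, three_swap_right ρ x w y, three_swap_right ρ x w' y]
  ring

theorem three_smul_two : ρ ![x, y, c • w] = c * ρ ![x, y, w] := by
  rw [three_swap_right, three_smul_one, three_swap_right ρ x w y]
  ring

theorem three_zero : ρ ![0, y, w] = 0 :=
  ρ.map_coord_zero 0 rfl

theorem three_self_left : ρ ![x, x, y] = 0 :=
  ρ.map_eq_zero_of_eq _ (i := 0) (j := 1) rfl (by decide)

theorem three_self_right : ρ ![x, y, y] = 0 :=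
  ρ.map_eq_zero_of_eq _ (i := 1) (j := 2) rfl (by decide)

theorem three_self_outer : ρ ![x, y, x] = 0 :=
  ρ.map_eq_zero_of_eq _ (i := 0) (j := 2) rfl (by decide)

end Multilinear

/-! ### Isotropy of the centre and horizontal differentials -/

/-- With a central argument `z`, the only bracket that can survive does not involve `z`. It is
central, so its term pairs two central vectors. -/
theorem horizontal_d_two {ω : Form 2}
    (h : ∀ z ∈ center ℝ H3H3, ∀ z' ∈ center ℝ H3H3, ω ![z, z'] = 0) : Horizontal (d ω) := by
  refine horizontal_of_cons fun z hz v => ?_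
  rw [vec_two_eq v, d_two, lie_eq_zero_of_mem_center hz, lie_eq_zero_of_mem_center hz,
    two_zero_left, two_zero_left, h _ (lie_mem_center _ _) z hz]
  simp

theorem horizontal_d_three {ρ : Form 3} (h : CenterIsotropic ρ) : Horizontal (d ρ) := by
  refine horizontal_of_cons fun z hz v => ?_
  rw [vec_three_eq v, d_three, lie_eq_zero_of_mem_center hz, lie_eq_zero_of_mem_center hz,
    lie_eq_zero_of_mem_center hz, three_zero, three_zero, three_zero,
    h _ (lie_mem_center _ _) z hz, h _ (lie_mem_center _ _) z hz, h _ (lie_mem_center _ _) z hz]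
  simp

/-- In `dρ(u, v, z, x) = 0` every bracket except `[u, v]` vanishes. -/
theorem apply_eq_zero_of_closed {ρ : Form 3} (h : d ρ = 0) {u v z x : H3H3}
    (hz : z ∈ center ℝ H3H3) (hu : ⁅u, x⁆ = 0) (hv : ⁅v, x⁆ = 0) : ρ ![⁅u, v⁆, z, x] = 0 := by
  have h1 := d_three ρ u v z x
  have h2 : ∀ w, ⁅w, z⁆ = 0 := fun w => by rw [← lie_skew, lie_eq_zero_of_mem_center hz, neg_zero]
  rw [h, hu, hv, h2, h2, lie_eq_zero_of_mem_center hz] at h1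
  simp only [three_zero, AlternatingMap.zero_apply] at h1
  linarith

theorem centerIsotropic_of_basis {ρ : Form 3} (h : ∀ x, ρ ![basis 2, basis 5, x] = 0) :
    CenterIsotropic ρ := by
  intro z hz z' hz' x
  obtain ⟨a, b, rfl⟩ := exists_of_mem_center hz
  obtain ⟨a', b', rfl⟩ := exists_of_mem_center hz'
  simp only [three_add_zero, three_add_one, three_smul_zero, three_smul_one, three_self_left, h,
    three_swap_left ρ (basis 2) (basis 5)]
  ring

/-- The two summands commute. Writing `e₃ = [e₁, e₂]` handles a third argument `f₁` or `f₂`; writing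
`f₃ = [f₁, f₂]` handles `e₁` or `e₂`. -/
theorem centerIsotropic_of_closed {ρ : Form 3} (h : d ρ = 0) : CenterIsotropic ρ := by
  refine centerIsotropic_of_basis fun x => ?_
  have h0 : ∀ k ∈ ({3, 4} : Finset (Fin 6)), ρ ![basis 2, basis 5, basis k] = 0 := by
    intro k hk
    rw [← lie_basis_zero_one]
    refine apply_eq_zero_of_closed h basis_five_mem_center ?_ ?_ <;> rw [lie_eq] <;>
      fin_cases hk <;> simp [basis_fst_zero, basis_fst_one, basis_snd_zero, basis_snd_one]
  have h1 : ∀ k ∈ ({0, 1} : Finset (Fin 6)), ρ ![basis 2, basis 5, basis k] = 0 := by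
    intro k hk
    rw [three_swap_left, ← lie_basis_three_four, neg_eq_zero]
    refine apply_eq_zero_of_closed h basis_two_mem_center ?_ ?_ <;> rw [lie_eq] <;>
      fin_cases hk <;> simp [basis_fst_zero, basis_fst_one, basis_snd_zero, basis_snd_one]
  rw [eq_sum_basis x]
  simp only [three_add_two, three_smul_two, three_self_right, three_self_outer,
    h0 3 (by decide), h0 4 (by decide), h1 0 (by decide), h1 1 (by decide)]
  ring

/-! ### Two-forms and their squares -/

/-- The Pfaffian of a skew-symmetric `6 × 6` array. -/
def pfaffian (a : Fin 6 → Fin 6 → ℝ) : ℝ :=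
  a 0 1 * (a 2 3 * a 4 5 - a 2 4 * a 3 5 + a 2 5 * a 3 4) -
  a 0 2 * (a 1 3 * a 4 5 - a 1 4 * a 3 5 + a 1 5 * a 3 4) +
  a 0 3 * (a 1 2 * a 4 5 - a 1 4 * a 2 5 + a 1 5 * a 2 4) -
  a 0 4 * (a 1 2 * a 3 5 - a 1 3 * a 2 5 + a 1 5 * a 2 3) +
  a 0 5 * (a 1 2 * a 3 4 - a 1 3 * a 2 4 + a 1 4 * a 2 3)

/-- The coefficients of a two-form. -/
def coeff (ω : Form 2) (i j : Fin 6) : ℝ := ω ![basis i, basis j]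

/-- The bivector dual to a four-form, as a matrix of coefficients. -/
def dualMatrix (s : Fin 6 → Fin 6 → Fin 6 → Fin 6 → ℝ) : Matrix (Fin 6) (Fin 6) ℝ :=
  .of ![![0, -s 2 3 4 5, s 1 3 4 5, -s 1 2 4 5, s 1 2 3 5, -s 1 2 3 4],
    ![s 2 3 4 5, 0, -s 0 3 4 5, s 0 2 4 5, -s 0 2 3 5, s 0 2 3 4],
    ![-s 1 3 4 5, s 0 3 4 5, 0, -s 0 1 4 5, s 0 1 3 5, -s 0 1 3 4],
    ![s 1 2 4 5, -s 0 2 4 5, s 0 1 4 5, 0, -s 0 1 2 5, s 0 1 2 4],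
    ![-s 1 2 3 5, s 0 2 3 5, -s 0 1 3 5, s 0 1 2 5, 0, -s 0 1 2 3],
    ![s 1 2 3 4, -s 0 2 3 4, s 0 1 3 4, -s 0 1 2 4, s 0 1 2 3, 0]]

/-- The Pfaffian analogue of the adjugate identity: the entries of the second factor are the signed
Pfaffians of the `4 × 4` subarrays, so each product of a row with a column is a Pfaffian expansion.
-/
theorem mul_dualMatrix (a : Fin 6 → Fin 6 → ℝ) (ha : ∀ i j, a j i = -a i j) :
    Matrix.of a * dualMatrix (fun i j k l => a i j * a k l - a i k * a j l + a i l * a j k) =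
      pfaffian a • (1 : Matrix (Fin 6) (Fin 6) ℝ) := by
  have h0 : ∀ i, a i i = 0 := fun i => by linarith [ha i i]
  have h : a = ![![0, a 0 1, a 0 2, a 0 3, a 0 4, a 0 5],
    ![-a 0 1, 0, a 1 2, a 1 3, a 1 4, a 1 5],
    ![-a 0 2, -a 1 2, 0, a 2 3, a 2 4, a 2 5],
    ![-a 0 3, -a 1 3, -a 2 3, 0, a 3 4, a 3 5],
    ![-a 0 4, -a 1 4, -a 2 4, -a 3 4, 0, a 4 5],
    ![-a 0 5, -a 1 5, -a 2 5, -a 3 5, -a 4 5, 0]] := by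
    funext i j
    fin_cases i <;> fin_cases j <;> simp [h0, ← ha]
  ext i j
  rw [Matrix.mul_apply, Matrix.smul_apply, Fin.sum_univ_six, pfaffian]
  conv_lhs => rw [h]
  fin_cases i <;> fin_cases j <;> simp [dualMatrix] <;> ring

theorem sigma_apply (ω : Form 2) (x y z w : H3H3) : sigma ω ![x, y, z, w] =
    ω ![x, y] * ω ![z, w] - ω ![x, z] * ω ![y, w] + ω ![x, w] * ω ![y, z] := by
  rw [sigma, AlternatingMap.smul_apply, wedge_two_two]
  simp
  ring

theorem cube_basis (ω : Form 2) : cube ω basis = 6 * pfaffian (coeff ω) := by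
  have h := wedge_four_two (wedge ω ω) ω basis
  have e : ∀ a b c d, wedge ω ω ![a, b, c, d] = _ := fun a b c d => wedge_two_two ω ω ![a, b, c, d]
  simp only [e] at h
  simp only [Matrix.cons_val] at h
  have h' : cube ω basis = wedge (wedge ω ω) ω basis := rfl
  rw [h', h]
  simp only [pfaffian, coeff]
  ring

theorem coeff_swap (ω : Form 2) (i j : Fin 6) : coeff ω j i = -coeff ω i j :=
  two_swap ω _ _

theorem ext_coeff {ω ω' : Form 2} (h : ∀ i j, coeff ω i j = coeff ω' i j) : ω = ω' := by
  refine Module.Basis.ext_alternating basis fun u _ => ?_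
  rw [vec_two_eq fun i => basis (u i)]
  exact h _ _

theorem wedge_self_eq (ω : Form 2) : (wedge ω ω : Form 4) = (2 : ℝ) • sigma ω := by
  rw [sigma, smul_smul]
  norm_num

theorem wedge_zero_left {p q : ℕ} (β : Form q) : wedge (0 : Form p) β = 0 := by
  simpa using wedge_smul_left (0 : ℝ) (0 : Form p) β

theorem sigma_smul (c : ℝ) (ω : Form 2) : sigma (c • ω) = c ^ 2 • sigma ω := by
  ext v
  have hv : v = ![v 0, v 1, v 2, v 3] := by funext i; fin_cases i <;> rfl
  rw [hv, AlternatingMap.smul_apply, sigma_apply, sigma_apply]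
  simp only [AlternatingMap.smul_apply, smul_eq_mul]
  ring

/-- A non-degenerate two-form is determined up to sign by its square. -/
theorem eq_or_eq_neg_of_sigma_eq {ω ω' : Form 2} (h : sigma ω' = sigma ω)
    (hω : pfaffian (coeff ω) ≠ 0) : ω' = ω ∨ ω' = -ω := by
  have e : ∀ η : Form 2, (fun i j k l => coeff η i j * coeff η k l - coeff η i k * coeff η j l +
      coeff η i l * coeff η j k) =
      fun i j k l : Fin 6 => sigma η ![basis i, basis j, basis k, basis l] := fun η => by
    funext i j k l
    rw [sigma_apply]
    rfl
  set D := dualMatrix fun i j k l : Fin 6 => sigma ω ![basis i, basis j, basis k, basis l] with hD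
  set p := pfaffian (coeff ω)
  have h1 := mul_dualMatrix (coeff ω) (coeff_swap ω)
  have h2 := mul_dualMatrix (coeff ω') (coeff_swap ω')
  rw [e, ← hD] at h1
  rw [e, h, ← hD] at h2
  -- Both forms share `D`. From `A D = p` follows `D A = p`, and with `A' D = p'` this gives `p A' =
  -- A' D A = p' A`. So `ω'` is a multiple of `ω`, and equality of the squares makes the factor
  -- `±1`.
  have h3 : D * Matrix.of (coeff ω) = p • 1 := by
    have h4 : (p⁻¹ • Matrix.of (coeff ω)) * D = 1 := by
      rw [Matrix.smul_mul, h1, smul_smul, inv_mul_cancel₀ hω, one_smul]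
    have h5 := mul_eq_one_comm.1 h4
    rw [Matrix.mul_smul] at h5
    rw [← h5, smul_smul, mul_inv_cancel₀ hω, one_smul]
  set c := p⁻¹ * pfaffian (coeff ω') with hc
  have h6 : ω' = c • ω := by
    refine ext_coeff fun i j => ?_
    have h7 : p • Matrix.of (coeff ω') = pfaffian (coeff ω') • Matrix.of (coeff ω) := by
      rw [← Matrix.mul_one (Matrix.of (coeff ω')), ← Matrix.mul_smul, ← h3, ← Matrix.mul_assoc, h2,
        Matrix.smul_mul, Matrix.one_mul]
    have h8 := congrFun (congrFun h7 i) j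
    simp only [Matrix.smul_apply, Matrix.of_apply, smul_eq_mul] at h8
    have h9 : coeff (c • ω) i j = c * coeff ω i j := rfl
    rw [h9, hc, mul_assoc, ← h8, inv_mul_cancel_left₀ hω]
  have h10 : sigma ω ≠ 0 := by
    intro h0
    apply hω
    have h11 := cube_basis ω
    have h12 : cube ω = 0 := by
      rw [cube, wedge_self_eq, h0, smul_zero]
      exact wedge_zero_left ω
    rw [h12, AlternatingMap.zero_apply] at h11
    linarith
  have h13 : c ^ 2 = 1 := by
    rw [h6, sigma_smul] at h
    obtain ⟨v, hv⟩ : ∃ v, sigma ω v ≠ 0 := by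
      by_contra! h0
      exact h10 (AlternatingMap.ext h0)
    have h14 := congrArg (fun θ : Form 4 => θ v) h
    simp only [AlternatingMap.smul_apply, smul_eq_mul] at h14
    exact mul_right_cancel₀ hv (by rw [h14, one_mul])
  rcases sq_eq_one_iff.1 h13 with h16 | h16
  · left; rw [h6, h16, one_smul]
  · right
    ext v
    rw [h6, h16, AlternatingMap.smul_apply, AlternatingMap.neg_apply, smul_eq_mul, neg_one_mul]

/-! ### Stable two-forms -/

/-- The wedge product of two elements of the dual basis. -/
def coordPair (i j : Fin 6) : Form 2 :=
  (Matrix.detRowAlternating (R := ℝ) (n := Fin 2)).compLinearMap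
    (LinearMap.pi ![basis.coord i, basis.coord j])

theorem coeff_coordPair (i j k l : Fin 6) : coeff (coordPair i j) k l =
    (if k = i then 1 else 0) * (if l = j then 1 else 0) -
      (if k = j then 1 else 0) * (if l = i then 1 else 0) := by
  rw [coeff, coordPair, AlternatingMap.compLinearMap_apply]
  refine (Matrix.det_fin_two (.of fun m =>
    LinearMap.pi ![basis.coord i, basis.coord j] (![basis k, basis l] m))).trans ?_
  simp [Finsupp.single_apply]

/-- If `ω³ = 0`, the same holds on the whole orbit. Openness then makes `Pf(ω + t η)` vanish for
small `t`, although for the standard symplectic form `η` it is a cubic in `t` with leading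
coefficient 1. -/
theorem pfaffian_ne_zero_of_isStable {ω : Form 2} (h : IsStable ω) : pfaffian (coeff ω) ≠ 0 := by
  intro h0
  let η : Form 2 := coordPair 0 1 + coordPair 2 3 + coordPair 4 5
  have hη : ∀ i j, coeff η i j =
      coeff (coordPair 0 1) i j + coeff (coordPair 2 3) i j + coeff (coordPair 4 5) i j :=
    fun i j => rfl
  have hadd : ∀ (t : ℝ) i j, coeff (ω + t • η) i j = coeff ω i j + t * coeff η i j :=
    fun t i j => rfl
  have hcont : @Continuous ℝ (Form 2) _ (formTopology H3H3 2) (fun t : ℝ => ω + t • η) := by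
    rw [continuous_induced_rng]
    refine continuous_pi fun v => ?_
    change Continuous fun t : ℝ => ω v + t * η v
    fun_prop
  have hopen : IsOpen ((fun t : ℝ => ω + t • η) ⁻¹' orbit ω) :=
    @IsOpen.preimage _ _ _ (formTopology H3H3 2) _ hcont _ h
  have hmem : (0 : ℝ) ∈ (fun t : ℝ => ω + t • η) ⁻¹' orbit ω :=
    ⟨LinearEquiv.refl ℝ H3H3, by ext v; simp⟩
  obtain ⟨ε, hε, hball⟩ := Metric.isOpen_iff.1 hopen 0 hmem
  have hcube : cube ω = 0 := by
    rw [(cube ω).eq_smul_basis_det basis, cube_basis, h0, mul_zero, zero_smul]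
  have hpf : ∀ t : ℝ, |t| < ε → pfaffian (coeff (ω + t • η)) = 0 := by
    intro t ht
    obtain ⟨g, hg⟩ := hball (by simpa using ht : t ∈ Metric.ball (0 : ℝ) ε)
    have h1 : cube (ω + t • η) = (cube ω).compLinearMap (g : H3H3 →ₗ[ℝ] H3H3) := by
      have hg' : ω + t • η = ω.compLinearMap (g : H3H3 →ₗ[ℝ] H3H3) := hg
      rw [hg', cube, wedge_compLinearMap, wedge_compLinearMap]
      rfl
    have h2 := cube_basis (ω + t • η)
    rw [h1, hcube] at h2
    simpa using h2.symm
  -- The third difference at `0, h, 2h, 3h`, with `h = ε / 4` so that all nodes lie in the ball,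
  -- isolates the cubic coefficient: it equals `6 h³`.
  have e1 := hpf (ε / 4) (by rw [abs_of_pos (by positivity)]; linarith)
  have e2 := hpf (2 * (ε / 4)) (by rw [abs_of_pos (by positivity)]; linarith)
  have e3 := hpf (3 * (ε / 4)) (by rw [abs_of_pos (by positivity)]; linarith)
  have key : pfaffian (coeff (ω + (3 * (ε / 4)) • η)) -
      3 * pfaffian (coeff (ω + (2 * (ε / 4)) • η)) + 3 * pfaffian (coeff (ω + (ε / 4) • η)) -
      pfaffian (coeff ω) = 6 * (ε / 4) ^ 3 := by
    simp only [pfaffian, hadd, hη, coeff_coordPair]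
    simp [Fin.ext_iff]
    ring
  rw [e1, e2, e3, h0] at key
  have : 0 < (ε / 4) ^ 3 := by positivity
  linarith

/-! ### The endomorphism `K` under central automorphisms -/

/-- Replacing the `k`-th basis vector by `w` multiplies `ν basis` by the `k`-th coordinate of `w`.
-/
theorem eq_zero_of_curryLeft_eq_zero {ν : Form 6} (hν : ν ≠ 0) {w : H3H3}
    (h : ν.curryLeft w = 0) : w = 0 := by
  have hb : ν basis ≠ 0 := fun h0 => hν (by
    rw [ν.eq_smul_basis_det basis, h0, zero_smul])
  have h1 : ∀ v : Fin 6 → H3H3, ∀ i, v i = w → ν v = 0 := by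
    intro v i hi
    have h1 := ν.map_perm v (Equiv.swap 0 i)
    have h2 : ν (v ∘ Equiv.swap 0 i) = 0 := by
      have h3 : ν.curryLeft w (Matrix.vecTail (v ∘ Equiv.swap 0 i)) = 0 := by
        rw [h, AlternatingMap.zero_apply]
      rw [← h3, AlternatingMap.curryLeft_apply_apply]
      congr 1
      funext j
      refine Fin.cases ?_ (fun j => ?_) j <;> simp [Matrix.vecTail, hi]
    rw [h2] at h1
    exact (smul_eq_zero_iff_eq _).1 h1.symm
  refine basis.repr.map_eq_zero_iff.1 (Finsupp.ext fun k => ?_)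
  have h2 := h1 (Function.update basis k w) k (Function.update_self _ _ _)
  conv at h2 => lhs; rw [← basis.sum_repr w]
  rw [AlternatingMap.map_update_sum, Finset.sum_eq_single k] at h2
  · rw [AlternatingMap.map_update_smul, Function.update_eq_self, smul_eq_zero] at h2
    simpa [hb] using h2
  · intro i _ hik
    rw [AlternatingMap.map_update_smul, ν.map_update_self basis hik.symm, smul_zero]
  · simp

/-- `K` is natural in the pair `(ν, ρ)`, and `g` preserves `ν`. Thus `K` of the pullback is the
conjugate of `K` by `g`. -/
theorem K_comp_central {ν : Form 6} (hν : ν ≠ 0) (ρ : Form 3) {g : H3H3 ≃ₗ[ℝ] H3H3}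
    (hg : IsCentral g) (x : H3H3) :
    g (K ν (ρ.compLinearMap (g : H3H3 →ₗ[ℝ] H3H3)) x) = K ν ρ (g x) := by
  rw [← sub_eq_zero, ← map_eq_zero_iff _ g.symm.injective]
  refine eq_zero_of_curryLeft_eq_zero hν ?_
  rw [map_sub, LinearEquiv.symm_apply_apply, map_sub, curryLeft_K hν, sub_eq_zero]
  have h1 : ∀ w, ν.curryLeft (g.symm w) =
      (ν.curryLeft w).compLinearMap (g : H3H3 →ₗ[ℝ] H3H3) := by
    intro w
    conv_lhs => rw [← hg.comp_six ν]
    ext v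
    simp only [AlternatingMap.curryLeft_apply_apply, AlternatingMap.compLinearMap_apply]
    congr 1
    funext i
    refine Fin.cases ?_ (fun i => ?_) i <;> simp
  have h2 : (ρ.compLinearMap (g : H3H3 →ₗ[ℝ] H3H3)).curryLeft x =
      (ρ.curryLeft (g x)).compLinearMap (g : H3H3 →ₗ[ℝ] H3H3) := by
    ext v
    simp only [AlternatingMap.curryLeft_apply_apply, AlternatingMap.compLinearMap_apply]
    congr 1
    funext i
    refine Fin.cases ?_ (fun i => ?_) i <;> simp
  rw [h1, curryLeft_K hν, h2, wedge_compLinearMap]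

theorem quartic_comp_central {ν : Form 6} (hν : ν ≠ 0) (ρ : Form 3) {g : H3H3 ≃ₗ[ℝ] H3H3}
    (hg : IsCentral g) : quartic ν (ρ.compLinearMap (g : H3H3 →ₗ[ℝ] H3H3)) = quartic ν ρ := by
  have h : K ν ρ ∘ₗ K ν ρ = g.conj (K ν (ρ.compLinearMap (g : H3H3 →ₗ[ℝ] H3H3)) ∘ₗ
      K ν (ρ.compLinearMap (g : H3H3 →ₗ[ℝ] H3H3))) := by
    refine LinearMap.ext fun x => ?_
    obtain ⟨y, rfl⟩ := g.surjective x
    simp [LinearEquiv.conj_apply, ← K_comp_central hν ρ hg]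
  rw [quartic, quartic, h, LinearMap.trace_conj']

theorem liouville_ne_zero {ω : Form 2} (h : pfaffian (coeff ω) ≠ 0) : liouville ω ≠ 0 := by
  intro h0
  have h1 := cube_basis ω
  have h2 := congrArg (fun θ : Form 6 => θ basis) h0
  simp only [liouville, AlternatingMap.smul_apply, h1, AlternatingMap.zero_apply, smul_eq_mul] at h2
  exact h (by linarith)

theorem liouville_comp_central (ω : Form 2) {g : H3H3 ≃ₗ[ℝ] H3H3} (hg : IsCentral g) :
    liouville (ω.compLinearMap (g : H3H3 →ₗ[ℝ] H3H3)) = liouville ω := by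
  have h : cube (ω.compLinearMap (g : H3H3 →ₗ[ℝ] H3H3)) = cube ω := by
    rw [cube, wedge_compLinearMap, wedge_compLinearMap]
    exact hg.comp_six (cube ω)
  rw [liouville, h, liouville]

theorem dual_comp_central {ω : Form 2} (hω : pfaffian (coeff ω) ≠ 0) (ρ : Form 3)
    {g : H3H3 ≃ₗ[ℝ] H3H3} (hg : IsCentral g) :
    dual ω (ρ.compLinearMap (g : H3H3 →ₗ[ℝ] H3H3)) =
      (dual ω ρ).compLinearMap (g : H3H3 →ₗ[ℝ] H3H3) := by
  have hν := liouville_ne_zero hω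
  ext v
  simp only [dual, AlternatingMap.compLinearMap_apply, J, quartic_comp_central hν ρ hg,
    LinearMap.smul_apply, map_smul, LinearEquiv.coe_coe, K_comp_central hν ρ hg]

/-! ### Three-forms for which the centre is isotropic -/

theorem CenterIsotropic.outer {ρ : Form 3} (h : CenterIsotropic ρ) {z z' : H3H3}
    (hz : z ∈ center ℝ H3H3) (hz' : z' ∈ center ℝ H3H3) (x : H3H3) : ρ ![z, x, z'] = 0 := by
  rw [three_swap_right, h z hz z' hz', neg_zero]

theorem CenterIsotropic.right {ρ : Form 3} (h : CenterIsotropic ρ) {z z' : H3H3}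
    (hz : z ∈ center ℝ H3H3) (hz' : z' ∈ center ℝ H3H3) (x : H3H3) : ρ ![x, z, z'] = 0 := by
  rw [three_swap_left, h.outer hz hz', neg_zero]

theorem curryLeft_vec (ρ : Form 3) (x y z : H3H3) : ρ.curryLeft x ![y, z] = ρ ![x, y, z] := rfl

/-- Pigeonhole: in each shuffle term, two of the three central vectors `z`, `v i`, `v j` sit in the
same factor `ρ`. -/
theorem CenterIsotropic.wedge_curryLeft_eq_zero {ρ : Form 3} (h : CenterIsotropic ρ) {z : H3H3}
    (hz : z ∈ center ℝ H3H3) (v : Fin 5 → H3H3) {i j : Fin 5} (hij : i < j)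
    (hi : v i ∈ center ℝ H3H3) (hj : v j ∈ center ℝ H3H3) :
    (wedge (ρ.curryLeft z) ρ : Form 5) v = 0 := by
  have e := wedge_two_three (ρ.curryLeft z) ρ v
  simp only [curryLeft_vec] at e
  refine e.trans ?_
  have l1 := fun x => h z hz (v i) hi x
  have l2 := fun x => h z hz (v j) hj x
  have l3 := fun x => h.outer hz hi x
  have l4 := fun x => h.outer hz hj x
  have l5 := fun x => h (v i) hi (v j) hj x
  have l6 := fun x => h.outer hi hj x
  have l7 := fun x => h.right hi hj x
  clear hi hj
  fin_cases i <;> fin_cases j <;> first | exact absurd hij (by decide) | skip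
  all_goals
    simp only [Fin.zero_eta, Fin.mk_one, Fin.reduceFinMk] at l1 l2 l3 l4 l5 l6 l7
    simp only [l1, l2, l3, l4, l5, l6, l7]
    ring

/-- A non-central coordinate of `K_ρ z` is computed by evaluating `(z ⌟ ρ) ∧ ρ` on the other five
basis vectors, which include both `e₃` and `f₃`. -/
theorem CenterIsotropic.K_mem {ρ : Form 3} (h : CenterIsotropic ρ) (ν : Form 6) {z : H3H3}
    (hz : z ∈ center ℝ H3H3) : K ν ρ z ∈ center ℝ H3H3 := by
  have hk2 : ∀ k ∈ ({0, 1, 3, 4} : Finset (Fin 6)), ∃ i j : Fin 5,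
      i < j ∧ k.succAbove i = 2 ∧ k.succAbove j = 5 := by
    decide
  have h0 : ∀ k ∈ ({0, 1, 3, 4} : Finset (Fin 6)), basis.repr (K ν ρ z) k = 0 := by
    intro k hk
    have h1 : basis.repr (K ν ρ z) k = (-1 : ℝ) ^ (k : ℕ) *
        (wedge (ρ.curryLeft z) ρ : Form 5) (fun j => basis (k.succAbove j)) / ν basis := by
      change basis.repr (vectorOf ν _) k = _
      rw [vectorOf, map_sum]
      simp [Finsupp.single_apply]
    obtain ⟨i, j, hij, hi, hj⟩ := hk2 k hk
    rw [h1, h.wedge_curryLeft_eq_zero hz (fun j => basis (k.succAbove j)) hij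
      (by rw [hi]; exact basis_two_mem_center) (by rw [hj]; exact basis_five_mem_center),
      mul_zero, zero_div]
  simp only [repr_basis] at h0
  exact mem_center_iff.2 ⟨h0 0 (by decide), h0 1 (by decide), h0 3 (by decide), h0 4 (by decide)⟩

theorem CenterIsotropic.dual {ρ : Form 3} (h : CenterIsotropic ρ) (ω : Form 2) :
    CenterIsotropic (dual ω ρ) := by
  have hJ : ∀ z ∈ center ℝ H3H3, J (liouville ω) ρ z ∈ center ℝ H3H3 := fun z hz =>
    (center ℝ H3H3).smul_mem _ (h.K_mem _ hz)
  intro z hz z' hz' x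
  rw [HitchinFlow.dual, AlternatingMap.compLinearMap_apply, vec_three_eq fun i => _]
  exact h _ (hJ z hz) _ (hJ z' hz') _

/-! ### Extensionality modulo horizontal forms -/

theorem Horizontal.eq_zero_of_three {θ : Form 3} (h : Horizontal θ)
    (h1 : θ ![basis 0, basis 1, basis 3] = 0) (h2 : θ ![basis 0, basis 1, basis 4] = 0)
    (h3 : θ ![basis 0, basis 3, basis 4] = 0) (h4 : θ ![basis 1, basis 3, basis 4] = 0) :
    θ = 0 := by
  refine ext_alternating_of_strictMono basis fun u hu => ?_
  have key : ∀ a b c : Fin 6, a < b → b < c → (a = 2 ∨ b = 2 ∨ c = 2 ∨ a = 5 ∨ b = 5 ∨ c = 5) ∨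
      (a = 0 ∧ b = 1 ∧ c = 3) ∨ (a = 0 ∧ b = 1 ∧ c = 4) ∨ (a = 0 ∧ b = 3 ∧ c = 4) ∨
      (a = 1 ∧ b = 3 ∧ c = 4) := by decide
  have hc : ∀ i, u i = 2 ∨ u i = 5 → θ (basis ∘ u) = 0 := by
    rintro i (hi | hi)
    · exact h _ i (by simpa [hi] using basis_two_mem_center)
    · exact h _ i (by simpa [hi] using basis_five_mem_center)
  rw [AlternatingMap.zero_apply]
  rcases key (u 0) (u 1) (u 2) (hu (by decide)) (hu (by decide)) with
    (e | e | e | e | e | e) | ⟨e1, e2, e3⟩ | ⟨e1, e2, e3⟩ | ⟨e1, e2, e3⟩ | ⟨e1, e2, e3⟩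
  · exact hc 0 (.inl e)
  · exact hc 1 (.inl e)
  · exact hc 2 (.inl e)
  · exact hc 0 (.inr e)
  · exact hc 1 (.inr e)
  · exact hc 2 (.inr e)
  all_goals
    rw [vec_three_eq (basis ∘ u)]
    simpa only [Function.comp_apply, e1, e2, e3]

theorem Horizontal.eq_zero_of_four {θ : Form 4} (h : Horizontal θ)
    (h1 : θ ![basis 0, basis 1, basis 3, basis 4] = 0) : θ = 0 := by
  refine ext_alternating_of_strictMono basis fun u hu => ?_
  have key : ∀ a b c e : Fin 6, a < b → b < c → c < e →
      (a = 2 ∨ b = 2 ∨ c = 2 ∨ e = 2 ∨ a = 5 ∨ b = 5 ∨ c = 5 ∨ e = 5) ∨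
      (a = 0 ∧ b = 1 ∧ c = 3 ∧ e = 4) := by decide
  have hc : ∀ i, u i = 2 ∨ u i = 5 → θ (basis ∘ u) = 0 := by
    rintro i (hi | hi)
    · exact h _ i (by simpa [hi] using basis_two_mem_center)
    · exact h _ i (by simpa [hi] using basis_five_mem_center)
  rw [AlternatingMap.zero_apply]
  rcases key (u 0) (u 1) (u 2) (u 3) (hu (by decide)) (hu (by decide)) (hu (by decide)) with
    (e | e | e | e | e | e | e | e) | ⟨e1, e2, e3, e4⟩
  · exact hc 0 (.inl e)
  · exact hc 1 (.inl e)
  · exact hc 2 (.inl e)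
  · exact hc 3 (.inl e)
  · exact hc 0 (.inr e)
  · exact hc 1 (.inr e)
  · exact hc 2 (.inr e)
  · exact hc 3 (.inr e)
  · have : basis ∘ u = ![basis 0, basis 1, basis 3, basis 4] := by
      funext i
      fin_cases i <;> simp [e1, e2, e3, e4]
    rw [this, h1]

theorem sub_eq_zero_form {k : ℕ} {α β : Form k} (h : α - β = 0) : α = β := by
  ext v
  have := congrArg (fun θ : Form k => θ v) h
  simpa [sub_eq_zero] using this

/-! ### The quartic invariant -/

/-- The polarised Pfaffian of two skew-symmetric arrays on the four non-central directions. -/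
def pairing (a b : Fin 6 → Fin 6 → ℝ) : ℝ :=
  a 0 1 * b 3 4 - a 0 3 * b 1 4 + a 0 4 * b 1 3 + a 1 3 * b 0 4 - a 1 4 * b 0 3 + a 3 4 * b 0 1

/-- The coefficients of the contraction `z ⌟ ρ`. -/
def contraction (ρ : Form 3) (z : H3H3) (i j : Fin 6) : ℝ := ρ ![z, basis i, basis j]

/-- The matrix entries of `K_ρ`, up to the normalisation of the volume form. -/
def entryK (ρ : Form 3) (i j : Fin 6) : ℝ :=
  (-1 : ℝ) ^ (i : ℕ) *
    (wedge (ρ.curryLeft (basis j)) ρ : Form 5) fun k => basis (i.succAbove k)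

theorem repr_K (ν : Form 6) (ρ : Form 3) (i j : Fin 6) :
    basis.repr (K ν ρ (basis j)) i = entryK ρ i j / ν basis := by
  change basis.repr (vectorOf ν _) i = _
  rw [vectorOf, map_sum, entryK]
  simp [Finsupp.single_apply]

theorem quartic_eq_sum (ν : Form 6) (ρ : Form 3) :
    quartic ν ρ = (∑ i, ∑ j, entryK ρ i j * entryK ρ j i) / (6 * ν basis ^ 2) := by
  rw [quartic, LinearMap.trace_eq_matrix_trace ℝ basis, LinearMap.toMatrix_comp basis basis basis,
    Matrix.trace]
  simp only [Matrix.diag_apply, Matrix.mul_apply, LinearMap.toMatrix_apply, repr_K, Finset.sum_div]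
  refine Finset.sum_congr rfl fun i _ => Finset.sum_congr rfl fun j _ => ?_
  ring

theorem wedge_form_two_three (α : Form 2) (β : Form 3) (v : Fin 5 → H3H3) :
    (wedge α β : Form 5) v =
      α ![v 0, v 1] * β ![v 2, v 3, v 4] - α ![v 0, v 2] * β ![v 1, v 3, v 4] +
      α ![v 0, v 3] * β ![v 1, v 2, v 4] - α ![v 0, v 4] * β ![v 1, v 2, v 3] +
      α ![v 1, v 2] * β ![v 0, v 3, v 4] - α ![v 1, v 3] * β ![v 0, v 2, v 4] +
      α ![v 1, v 4] * β ![v 0, v 2, v 3] + α ![v 2, v 3] * β ![v 0, v 1, v 4] -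
      α ![v 2, v 4] * β ![v 0, v 1, v 3] + α ![v 3, v 4] * β ![v 0, v 1, v 2] :=
  wedge_two_three α β v

theorem entryK_eq (ρ : Form 3) (i j : Fin 6) (r : Fin 6 → Fin 6 → Fin 6 → ℝ)
    (hr : r = fun i j k => ρ ![basis i, basis j, basis k]) (s : Fin 5 → Fin 6)
    (hs : i.succAbove = s) :
    entryK ρ i j = (-1 : ℝ) ^ (i : ℕ) * (
      r j (s 0) (s 1) * r (s 2) (s 3) (s 4) - r j (s 0) (s 2) * r (s 1) (s 3) (s 4) +
      r j (s 0) (s 3) * r (s 1) (s 2) (s 4) - r j (s 0) (s 4) * r (s 1) (s 2) (s 3) +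
      r j (s 1) (s 2) * r (s 0) (s 3) (s 4) - r j (s 1) (s 3) * r (s 0) (s 2) (s 4) +
      r j (s 1) (s 4) * r (s 0) (s 2) (s 3) + r j (s 2) (s 3) * r (s 0) (s 1) (s 4) -
      r j (s 2) (s 4) * r (s 0) (s 1) (s 3) + r j (s 3) (s 4) * r (s 0) (s 1) (s 2)) := by
  rw [entryK, wedge_form_two_three, hr, ← hs]
  rfl

/-- With isotropic centre, `λ(ρ)` reduces, up to the volume factor, to minus the determinant of the
quadratic form `m ↦ (m ⌟ ρ)²` on the two-dimensional centre. This is a polynomial identity once the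
isotropic coefficients are dropped. -/
theorem CenterIsotropic.sum_entryK {ρ : Form 3} (h : CenterIsotropic ρ) :
    ∑ i, ∑ j, entryK ρ i j * entryK ρ j i =
      6 * (pairing (contraction ρ (basis 2)) (contraction ρ (basis 5)) ^ 2 -
        pairing (contraction ρ (basis 2)) (contraction ρ (basis 2)) *
        pairing (contraction ρ (basis 5)) (contraction ρ (basis 5))) := by
  obtain ⟨r, hr⟩ : ∃ r : Fin 6 → Fin 6 → Fin 6 → ℝ,
      r = fun i j k => ρ ![basis i, basis j, basis k] := ⟨_, rfl⟩
  have hc : ∀ i j k, contraction ρ (basis i) j k = r i j k := by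
    intro i j k
    rw [hr, contraction]
  have hs1 : ∀ i j k, i < j → r j i k = -r i j k := by
    intro i j k _
    simp only [hr]
    exact three_swap_left _ _ _ _
  have hs2 : ∀ i j k, j < k → r i k j = -r i j k := by
    intro i j k _
    simp only [hr]
    exact three_swap_right _ _ _ _
  have z1 : ∀ i j, r i i j = 0 := fun i j => by simp only [hr]; exact three_self_left _ _ _
  have z3 : ∀ i j, r i j i = 0 := fun i j => by simp only [hr]; exact three_self_outer _ _ _
  have z4 : ∀ i, r 2 5 i = 0 := fun i => by
    simp only [hr]; exact h _ basis_two_mem_center _ basis_five_mem_center _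
  have z5 : ∀ i, r 2 i 5 = 0 := fun i => by
    simp only [hr]; exact h.outer basis_two_mem_center basis_five_mem_center _
  have z6 : ∀ i, r i 2 5 = 0 := fun i => by
    simp only [hr]; exact h.right basis_two_mem_center basis_five_mem_center _
  have s0 : Fin.succAbove (0 : Fin 6) = ![1, 2, 3, 4, 5] := by decide
  have s1 : Fin.succAbove (1 : Fin 6) = ![0, 2, 3, 4, 5] := by decide
  have s2 : Fin.succAbove (2 : Fin 6) = ![0, 1, 3, 4, 5] := by decide
  have s3 : Fin.succAbove (3 : Fin 6) = ![0, 1, 2, 4, 5] := by decide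
  have s4 : Fin.succAbove (4 : Fin 6) = ![0, 1, 2, 3, 5] := by decide
  have s5 : Fin.succAbove (5 : Fin 6) = ![0, 1, 2, 3, 4] := by decide
  have n0 := fun j => entryK_eq ρ 0 j r hr _ s0
  have n1 := fun j => entryK_eq ρ 1 j r hr _ s1
  have n2 := fun j => entryK_eq ρ 2 j r hr _ s2
  have n3 := fun j => entryK_eq ρ 3 j r hr _ s3
  have n4 := fun j => entryK_eq ρ 4 j r hr _ s4
  have n5 := fun j => entryK_eq ρ 5 j r hr _ s5
  have hval : ((0 : Fin 6) : ℕ) = 0 ∧ ((1 : Fin 6) : ℕ) = 1 ∧ ((2 : Fin 6) : ℕ) = 2 ∧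
    ((3 : Fin 6) : ℕ) = 3 ∧ ((4 : Fin 6) : ℕ) = 4 ∧ ((5 : Fin 6) : ℕ) = 5 := by decide
  obtain ⟨v0, v1, v2, v3, v4, v5⟩ := hval
  simp only [Matrix.cons_val, v0, v1, v2, v3, v4, v5] at n0 n1 n2 n3 n4 n5
  clear hr
  simp only [Fin.sum_univ_six, n0, n1, n2, n3, n4, n5, pairing, hc]
  simp (discharger := decide) only [z1, z3, z4, z5, z6, hs1, hs2]
  ring

theorem CenterIsotropic.exists_pairing_ne_zero {ρ : Form 3} (h : CenterIsotropic ρ) {ν : Form 6}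
    (hq : quartic ν ρ ≠ 0) :
    ∃ m ∈ center ℝ H3H3, pairing (contraction ρ m) (contraction ρ m) ≠ 0 := by
  by_contra! h0
  apply hq
  have h1 := h0 _ basis_two_mem_center
  have h2 := h0 _ basis_five_mem_center
  -- Evaluating on `e₃ + f₃` polarises: the mixed value vanishes as well, and with it `λ`.
  have h3 := h0 _ ((center ℝ H3H3).add_mem basis_two_mem_center basis_five_mem_center)
  have h4 : pairing (contraction ρ (basis 2)) (contraction ρ (basis 5)) = 0 := by
    simp only [pairing, contraction, three_add_zero] at h1 h2 h3 ⊢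
    linarith
  rw [quartic_eq_sum, h.sum_entryK, h1, h4]
  simp

/-- Two three-forms with isotropic centre that differ by a horizontal form are related by a central
automorphism. -/
theorem CenterIsotropic.exists_central {ρ : Form 3} (h : CenterIsotropic ρ) {ν : Form 6}
    (hq : quartic ν ρ ≠ 0) {D : Form 3} (hD : Horizontal D) :
    ∃ g : H3H3 ≃ₗ[ℝ] H3H3, IsCentral g ∧
      ρ.compLinearMap (g : H3H3 →ₗ[ℝ] H3H3) = ρ + D := by
  -- Set `μ = m ⌟ ρ` and let `vol` be the unit four-form on `𝔤/𝔷`, so that `½ μ ∧ μ = (p / 2) vol`.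
  -- The automorphism `x ↦ x + ℓ(x) m` adds `ℓ ∧ μ` to `ρ`, so `ℓ ∧ μ = D` is to be solved. Choose
  -- `w` with `w ⌟ vol = D`; contracting with `w` gives `(w ⌟ μ) ∧ μ = (p / 2) D`, hence `ℓ = (2 /
  -- p) w ⌟ μ`.
  obtain ⟨m, hm, hp⟩ := h.exists_pairing_ne_zero hq
  set p := pairing (contraction ρ m) (contraction ρ m) with hpdef
  obtain ⟨w, hw⟩ : ∃ w : H3H3, ∀ x, ρ ![m, w, x] =
      D ![basis 1, basis 3, basis 4] * ρ ![m, basis 0, x] -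
      D ![basis 0, basis 3, basis 4] * ρ ![m, basis 1, x] +
      D ![basis 0, basis 1, basis 4] * ρ ![m, basis 3, x] -
      D ![basis 0, basis 1, basis 3] * ρ ![m, basis 4, x] :=
    ⟨D ![basis 1, basis 3, basis 4] • basis 0 + (-D ![basis 0, basis 3, basis 4]) • basis 1 +
      D ![basis 0, basis 1, basis 4] • basis 3 + (-D ![basis 0, basis 1, basis 3]) • basis 4,
      fun x => by simp only [three_add_one, three_smul_one]; ring⟩
  let ℓ : H3H3 →ₗ[ℝ] ℝ :=
    { toFun := fun x => 2 / p * ρ ![m, w, x]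
      map_add' := fun x y => by rw [three_add_two]; ring
      map_smul' := fun c x => by rw [three_smul_two, RingHom.id_apply, smul_eq_mul]; ring }
  have hℓ : ∀ x, ℓ x = 2 / p * ρ ![m, w, x] := fun x => rfl
  obtain ⟨g, hg, hgx⟩ := HitchinFlow.exists_central ℓ m
    (fun z hz => by rw [hℓ, h.outer hm hz, mul_zero]) hm
  have key : ∀ x y z, ρ.compLinearMap (g : H3H3 →ₗ[ℝ] H3H3) ![x, y, z] = ρ ![x, y, z] +
      (ℓ x * ρ ![m, y, z] - ℓ y * ρ ![m, x, z] + ℓ z * ρ ![m, x, y]) := by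
    intro x y z
    have e1 : ρ.compLinearMap (g : H3H3 →ₗ[ℝ] H3H3) ![x, y, z] =
        ρ ![x + ℓ x • m, y + ℓ y • m, z + ℓ z • m] := by
      rw [AlternatingMap.compLinearMap_apply, vec_three_eq fun i => _]
      simp [hgx]
    rw [e1]
    simp only [three_add_zero, three_add_one, three_add_two, three_smul_zero, three_smul_one,
      three_smul_two, three_self_left, three_self_right, three_self_outer,
      three_swap_left ρ m x z, three_swap_right ρ x m y, three_swap_left ρ m x y]
    ring
  refine ⟨g, hg, sub_eq_zero_form (Horizontal.eq_zero_of_three ?_ ?_ ?_ ?_ ?_)⟩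
  · refine horizontal_of_cons fun z hz v => ?_
    have e1 : ℓ z = 0 := by rw [hℓ, h.outer hm hz, mul_zero]
    have e2 : D ![z, v 0, v 1] = 0 := hD _ 0 hz
    rw [vec_two_eq v, AlternatingMap.sub_apply, AlternatingMap.add_apply, key, e1, e2,
      h m hm z hz, h m hm z hz]
    ring
  all_goals
    rw [AlternatingMap.sub_apply, AlternatingMap.add_apply, key, add_sub_add_left_eq_sub,
      sub_eq_zero, hℓ, hℓ, hℓ]
    rw [← mul_right_inj' hp]
    field_simp
    simp only [hw, hpdef, pairing, contraction, three_self_right,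
      three_swap_right ρ m (basis 0) (basis 1), three_swap_right ρ m (basis 0) (basis 3),
      three_swap_right ρ m (basis 0) (basis 4), three_swap_right ρ m (basis 1) (basis 3),
      three_swap_right ρ m (basis 1) (basis 4), three_swap_right ρ m (basis 3) (basis 4)]
    ring

/-! ### Two-forms with isotropic centre -/

theorem pfaffian_comp_central (ω : Form 2) {g : H3H3 ≃ₗ[ℝ] H3H3} (hg : IsCentral g) :
    pfaffian (coeff (ω.compLinearMap (g : H3H3 →ₗ[ℝ] H3H3))) = pfaffian (coeff ω) := by
  have h := congrArg (fun ν : Form 6 => ν basis) (liouville_comp_central ω hg)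
  simp only [liouville, AlternatingMap.smul_apply, cube_basis, smul_eq_mul] at h
  linarith

/-- `η r = ω + r (f₃ ⌟ ω) ∧ (e₃ ⌟ ω)`. -/
def IsShear (ω : Form 2) (η : ℝ → Form 2) : Prop :=
  ∀ r x y, η r ![x, y] = ω ![x, y] +
    r * (ω ![basis 5, x] * ω ![basis 2, y] - ω ![basis 5, y] * ω ![basis 2, x])

section Shear

variable {ω : Form 2} {η : ℝ → Form 2}

/-- Take `ℓ = r (f₃ ⌟ ω)` and `m = e₃` in `exists_central`; isotropy of the centre makes `ℓ` vanish
on it. -/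
theorem exists_shear
    (hz : ∀ x ∈ center ℝ H3H3, ∀ y ∈ center ℝ H3H3, ω ![x, y] = 0) :
    ∃ η : ℝ → Form 2, IsShear ω η ∧ ∀ r, ∃ g : H3H3 ≃ₗ[ℝ] H3H3, IsCentral g ∧
      η r = ω.compLinearMap (g : H3H3 →ₗ[ℝ] H3H3) := by
  have key : ∀ r : ℝ, ∃ g : H3H3 ≃ₗ[ℝ] H3H3, IsCentral g ∧
      ∀ x, g x = x + (r * ω ![basis 5, x]) • basis 2 := by
    intro r
    let ℓ : H3H3 →ₗ[ℝ] ℝ :=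
      { toFun := fun x => r * ω ![basis 5, x]
        map_add' := fun x y => by rw [two_add_right]; ring
        map_smul' := fun c x => by rw [two_smul_right, RingHom.id_apply, smul_eq_mul]; ring }
    exact exists_central ℓ (basis 2)
      (fun z hz' => by
        change r * ω ![basis 5, z] = 0
        rw [hz _ basis_five_mem_center z hz', mul_zero]) basis_two_mem_center
  choose g hg hgx using key
  refine ⟨fun r => ω.compLinearMap (g r : H3H3 →ₗ[ℝ] H3H3), fun r x y => ?_,
    fun r => ⟨g r, hg r, rfl⟩⟩
  rw [AlternatingMap.compLinearMap_apply, vec_two_eq fun i => _]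
  simp only [Matrix.cons_val, LinearEquiv.coe_coe, hgx, two_add_left, two_add_right,
    two_smul_left, two_smul_right, two_self, two_swap ω (basis 2) x]
  ring

theorem IsShear.apply_basis_two (hη : IsShear ω η) (h25 : ω ![basis 2, basis 5] = 0) (r : ℝ)
    (x : H3H3) : η r ![basis 2, x] = ω ![basis 2, x] := by
  rw [hη, two_self, two_swap ω (basis 2) (basis 5), h25]
  ring

/-- With `α = e₃ ⌟ ω` and `β = f₃ ⌟ ω`, the shear adds `r ω ∧ β ∧ α` to `σ`, since `β ∧ α` squares
to zero. This term is horizontal: `α`, `β` vanish on the centre, and contracting `ω` with a central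
vector gives a combination of `α` and `β`. Its value on `(e₁, e₂, f₁, f₂)` is `r Pf(ω)`, whence the
parameter. -/
theorem IsShear.sigma_eq (hη : IsShear ω η)
    (hz : ∀ x ∈ center ℝ H3H3, ∀ y ∈ center ℝ H3H3, ω ![x, y] = 0)
    (hp : pfaffian (coeff ω) ≠ 0) {θ : Form 4} (hθ : Horizontal θ) :
    sigma (η (θ ![basis 0, basis 1, basis 3, basis 4] / pfaffian (coeff ω))) = sigma ω + θ := by
  have h25 : ω ![basis 2, basis 5] = 0 := hz _ basis_two_mem_center _ basis_five_mem_center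
  set r := θ ![basis 0, basis 1, basis 3, basis 4] / pfaffian (coeff ω) with hr
  have hr' : r * pfaffian (coeff ω) = θ ![basis 0, basis 1, basis 3, basis 4] :=
    div_mul_cancel₀ _ hp
  refine sub_eq_zero_form (Horizontal.eq_zero_of_four ?_ ?_)
  · refine horizontal_of_cons fun z hz' v => ?_
    have e1 : θ (Matrix.vecCons z v) = 0 := hθ _ 0 hz'
    obtain ⟨a, b, rfl⟩ := exists_of_mem_center hz'
    rw [AlternatingMap.sub_apply, AlternatingMap.add_apply, e1, vec_three_eq v, sigma_apply,
      sigma_apply]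
    simp only [hη r, two_add_left, two_smul_left, two_add_right, two_smul_right, two_self, h25,
      two_swap ω (basis 2) (basis 5)]
    ring
  · rw [AlternatingMap.sub_apply, AlternatingMap.add_apply, sigma_apply, sigma_apply, ← hr']
    have h25' : coeff ω 2 5 = 0 := h25
    have e : ∀ i j, ω ![basis i, basis j] = coeff ω i j := fun _ _ => rfl
    simp only [hη r, e, pfaffian, h25', coeff_swap ω 0 2, coeff_swap ω 1 2, coeff_swap ω 0 5,
      coeff_swap ω 1 5, coeff_swap ω 3 5, coeff_swap ω 4 5]
    ring

end Shear

theorem exists_apply_basis_two_ne_zero {ω : Form 2} (hp : pfaffian (coeff ω) ≠ 0) :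
    ∃ x, ω ![basis 2, x] ≠ 0 := by
  by_contra! h
  have h1 : ∀ j, coeff ω 2 j = 0 := fun j => h _
  have h2 : ∀ j, coeff ω j 2 = 0 := fun j => by rw [coeff_swap ω 2 j, h1, neg_zero]
  apply hp
  simp [pfaffian, h1, h2]

/-! ### The Hitchin flow -/

theorem IsHStructure.quartic_ne_zero {ω : Form 2} {ρ : Form 3} (h : IsHStructure ω ρ) :
    quartic (liouville ω) ρ ≠ 0 := by
  intro h0
  obtain ⟨c, hc, hv⟩ := h.volume
  -- In the definition of `J`, `λ = 0` gives the factor `0⁻¹ = 0`. Then `ρ̂ = 0`, contradicting `c >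
  -- 0` and `ω³ ≠ 0`.
  have hJ : J (liouville ω) ρ = 0 := by
    rw [J, h0]
    simp
  have hd : dual ω ρ = 0 := by
    ext v
    rw [dual, AlternatingMap.compLinearMap_apply, hJ]
    exact (ρ.map_coord_zero 0 rfl)
  have h1 : (wedge (dual ω ρ) ρ : Form 6) = 0 := by
    rw [hd]
    exact wedge_zero_left ρ
  have h2 := congrArg (fun θ : Form 6 => θ basis) (h1.symm.trans hv)
  simp only [AlternatingMap.zero_apply, AlternatingMap.smul_apply, cube_basis, smul_eq_mul] at h2
  have h3 := pfaffian_ne_zero_of_isStable h.stable_two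
  have h4 : c / 3 * (6 * pfaffian (coeff ω)) ≠ 0 := by positivity
  exact h4 h2.symm

theorem dual_comp_central_left (ω : Form 2) (ρ : Form 3) {g : H3H3 ≃ₗ[ℝ] H3H3}
    (hg : IsCentral g) :
    dual (ω.compLinearMap (g : H3H3 →ₗ[ℝ] H3H3)) ρ = dual ω ρ := by
  rw [dual, liouville_comp_central ω hg, dual]

/-- The dual sees `ω` only through its volume form, which `g` preserves. With `ρ + D = f^* ρ` for a
central `f`, the differential of the dual becomes `f^* dρ̂ = dρ̂`, because `dρ̂` is horizontal. -/
theorem CenterIsotropic.d_dual_eq {ω : Form 2} (hp : pfaffian (coeff ω) ≠ 0) {ρ : Form 3}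
    (h : CenterIsotropic ρ) (hq : quartic (liouville ω) ρ ≠ 0) {g : H3H3 ≃ₗ[ℝ] H3H3}
    (hg : IsCentral g) {D : Form 3} (hD : Horizontal D) :
    d (HitchinFlow.dual (ω.compLinearMap (g : H3H3 →ₗ[ℝ] H3H3)) (ρ + D)) =
      d (HitchinFlow.dual ω ρ) := by
  obtain ⟨f, hf, hfρ⟩ := h.exists_central hq hD
  rw [dual_comp_central_left ω _ hg, ← hfρ, dual_comp_central hp ρ hf, hf.d_comp,
    (horizontal_d_three (h.dual ω)).comp_central hf]

theorem eq_of_hasDerivWithinAt_zero {I : Set ℝ} (hI : I.OrdConnected) {f : ℝ → ℝ}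
    (hf : ∀ t ∈ I, HasDerivWithinAt f 0 I t) {s t : ℝ} (hs : s ∈ I) (ht : t ∈ I) : f t = f s := by
  have h := hI.convex.norm_image_sub_le_of_norm_hasDerivWithin_le (C := 0) hf
    (fun _ _ => by simp) hs ht
  rw [zero_mul, norm_le_zero_iff, sub_eq_zero] at h
  exact h

/-- For every two-form `ω`, `dω(z, z', x) = 0` when `z` and `z'` are central: all three brackets
vanish. So `ρ(z, z', x)` is constant in time. -/
theorem IsHitchinFlow.centerIsotropic {I : Set ℝ} {ω : ℝ → Form 2} {ρ : ℝ → Form 3}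
    (h : IsHitchinFlow I ω ρ) (hI : I.OrdConnected) (h0 : 0 ∈ I) (hρ : CenterIsotropic (ρ 0))
    {t : ℝ} (ht : t ∈ I) : CenterIsotropic (ρ t) := by
  intro z hz z' hz' x
  rw [← hρ z hz z' hz' x]
  refine eq_of_hasDerivWithinAt_zero hI (f := fun s => ρ s ![z, z', x]) (fun s hs => ?_) h0 ht
  have h1 := h.deriv_three s hs ![z, z', x]
  rwa [d_two, lie_eq_zero_of_mem_center hz, lie_eq_zero_of_mem_center hz,
    lie_eq_zero_of_mem_center hz', two_zero_left, two_zero_left, two_zero_left, neg_zero,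
    add_zero, sub_zero] at h1

theorem IsHitchinFlow.horizontal_sigma_sub {I : Set ℝ} {ω : ℝ → Form 2} {ρ : ℝ → Form 3}
    (h : IsHitchinFlow I ω ρ) (hI : I.OrdConnected) (h0 : 0 ∈ I) (hρ : CenterIsotropic (ρ 0))
    {t : ℝ} (ht : t ∈ I) : Horizontal (sigma (ω t) - sigma (ω 0)) := by
  intro v i hi
  rw [AlternatingMap.sub_apply, sub_eq_zero]
  refine eq_of_hasDerivWithinAt_zero hI (f := fun s => sigma (ω s) v) (fun s hs => ?_) h0 ht
  have h1 := h.deriv_four s hs v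
  rwa [horizontal_d_three ((h.centerIsotropic hI h0 hρ hs).dual (ω s)) v i hi] at h1

/-- Along a solution with isotropic centre the two-form stays in the shear family. -/
theorem IsHitchinFlow.eq_shear {I : Set ℝ} {ω : ℝ → Form 2} {ρ : ℝ → Form 3}
    (h : IsHitchinFlow I ω ρ) (hI : I.OrdConnected) (h0 : 0 ∈ I) (hρ : CenterIsotropic (ρ 0))
    (hz : ∀ x ∈ center ℝ H3H3, ∀ y ∈ center ℝ H3H3, ω 0 ![x, y] = 0)
    (hp : pfaffian (coeff (ω 0)) ≠ 0) {η : ℝ → Form 2} (hη : IsShear (ω 0) η)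
    (hηp : ∀ r, pfaffian (coeff (η r)) ≠ 0) {t : ℝ} (ht : t ∈ I) :
    ω t = η ((sigma (ω t) - sigma (ω 0)) ![basis 0, basis 1, basis 3, basis 4] /
      pfaffian (coeff (ω 0))) := by
  have h25 : ω 0 ![basis 2, basis 5] = 0 := hz _ basis_two_mem_center _ basis_five_mem_center
  obtain ⟨x, hx⟩ := exists_apply_basis_two_ne_zero hp
  have hpm : ∀ s ∈ I, ω s = η ((sigma (ω s) - sigma (ω 0)) ![basis 0, basis 1, basis 3, basis 4] /
      pfaffian (coeff (ω 0))) ∨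
      ω s = -η ((sigma (ω s) - sigma (ω 0)) ![basis 0, basis 1, basis 3, basis 4] /
      pfaffian (coeff (ω 0))) := by
    intro s hs
    refine eq_or_eq_neg_of_sigma_eq ?_ (hηp _)
    rw [hη.sigma_eq hz hp (h.horizontal_sigma_sub hI h0 hρ hs)]
    ext v
    rw [AlternatingMap.add_apply, AlternatingMap.sub_apply, add_sub_cancel]
  have hsq : ∀ s ∈ I, ω s ![basis 2, x] = ω 0 ![basis 2, x] ∨
      ω s ![basis 2, x] = -ω 0 ![basis 2, x] := by
    intro s hs
    rcases hpm s hs with e | e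
    · left
      rw [e, hη.apply_basis_two h25]
    · right
      rw [e, AlternatingMap.neg_apply, hη.apply_basis_two h25]
  -- Shears do not change `e₃ ⌟ ω`, so `s ↦ ω_s(e₃, x)` is continuous with constant nonzero square
  -- on a connected set. Its sign cannot jump.
  have hconst : ω t ![basis 2, x] = ω 0 ![basis 2, x] :=
    IsPreconnected.eq_of_sq_eq (S := I) (f := fun s => ω s ![basis 2, x])
      (g := fun _ => ω 0 ![basis 2, x]) hI.isPreconnected (h.differentiable _).continuousOn
      continuousOn_const (fun s hs => by
        simp only [Pi.pow_apply]
        rcases hsq s hs with e | e <;> rw [e]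
        ring) (fun _ => hx) h0 rfl ht
  rcases hpm t ht with e | e
  · exact e
  · exfalso
    rw [e, AlternatingMap.neg_apply, hη.apply_basis_two h25] at hconst
    exact hx (by linarith)

end HitchinFlow

end

/-! ### Existence and uniqueness of the affine solution -/

theorem mainTheorem8 (ω₀ : HitchinFlow.Form 2) (ρ₀ : HitchinFlow.Form 3)
    (h₀ : HitchinFlow.IsHalfFlat ω₀ ρ₀)
    (hz : ∀ x ∈ LieAlgebra.center ℝ HitchinFlow.H3H3,
      ∀ y ∈ LieAlgebra.center ℝ HitchinFlow.H3H3, ω₀ ![x, y] = 0) :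
    ∃ (ω : ℝ → HitchinFlow.Form 2) (ρ : ℝ → HitchinFlow.Form 3),
      HitchinFlow.IsHitchinFlow Set.univ ω ρ ∧ ω 0 = ω₀ ∧ ρ 0 = ρ₀ ∧
      (∀ t : ℝ, HitchinFlow.sigma (ω t) =
        HitchinFlow.sigma ω₀ + t • HitchinFlow.d (HitchinFlow.dual ω₀ ρ₀)) ∧
      (∀ t : ℝ, ρ t = ρ₀ + t • HitchinFlow.d ω₀) ∧
      (∀ (I : Set ℝ) (ω' : ℝ → HitchinFlow.Form 2) (ρ' : ℝ → HitchinFlow.Form 3),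
        I.OrdConnected → 0 ∈ I → HitchinFlow.IsHitchinFlow I ω' ρ' → ω' 0 = ω₀ → ρ' 0 = ρ₀ →
        ∀ t ∈ I, ω' t = ω t ∧ ρ' t = ρ t) := by
  open HitchinFlow in
  have hp := pfaffian_ne_zero_of_isStable h₀.stable_two
  have hq := h₀.toIsHStructure.quartic_ne_zero
  have hρ := centerIsotropic_of_closed h₀.closed_three
  have hdω := horizontal_d_two hz
  have hdρ := horizontal_d_three (hρ.dual ω₀)
  obtain ⟨η, hη, hηg⟩ := exists_shear hz
  have hηp : ∀ r, pfaffian (coeff (η r)) ≠ 0 := fun r => by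
    obtain ⟨g, hg, hr⟩ := hηg r
    rwa [hr, pfaffian_comp_central ω₀ hg]
  have hηd : ∀ r, d (η r) = d ω₀ := fun r => by
    obtain ⟨g, hg, hr⟩ := hηg r
    rw [hr, hg.d_comp, hdω.comp_central hg]
  have hηdual : ∀ r t : ℝ, d (dual (η r) (ρ₀ + t • d ω₀)) = d (dual ω₀ ρ₀) := fun r t => by
    obtain ⟨g, hg, hr⟩ := hηg r
    rw [hr, hρ.d_dual_eq hp hq hg (hdω.smul t)]
  have hsig : ∀ t : ℝ, sigma (η ((t • d (dual ω₀ ρ₀)) ![basis 0, basis 1, basis 3, basis 4] /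
      pfaffian (coeff ω₀))) = sigma ω₀ + t • d (dual ω₀ ρ₀) :=
    fun t => hη.sigma_eq hz hp (hdρ.smul t)
  -- The shear parameter is the one that `IsShear.sigma_eq` assigns to `t dρ̂₀`. It is linear in
  -- `t`, and `η` is affine in it, so `ω` itself is affine in `t`.
  refine ⟨fun t => η ((t • d (dual ω₀ ρ₀)) ![basis 0, basis 1, basis 3, basis 4] /
    pfaffian (coeff ω₀)), fun t => ρ₀ + t • d ω₀, ⟨?_, ?_, ?_, ?_, ?_⟩, ?_, ?_, hsig,
    fun t => rfl, ?_⟩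
  · intro t _
    obtain ⟨g, hg, hr⟩ := hηg ((t • d (dual ω₀ ρ₀)) ![basis 0, basis 1, basis 3, basis 4] /
      pfaffian (coeff ω₀))
    rw [hr]
    exact h₀.stable_two.compLinearMap g
  · intro t _
    obtain ⟨g, hg, hr⟩ := hρ.exists_central hq (hdω.smul t)
    rw [← hr]
    exact h₀.stable_three.compLinearMap g
  · intro v
    rw [vec_two_eq v]
    simp only [hη _, AlternatingMap.smul_apply, smul_eq_mul]
    fun_prop
  · intro t _ v
    rw [hηd]
    simp only [AlternatingMap.add_apply, AlternatingMap.smul_apply, smul_eq_mul]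
    simpa using (((hasDerivAt_id t).mul_const (d ω₀ v)).const_add (ρ₀ v))
  · intro t _ v
    rw [hηdual]
    simp only [hsig, AlternatingMap.add_apply]
    simpa using
      (((hasDerivAt_id t).mul_const (d (dual ω₀ ρ₀) v)).const_add (sigma ω₀ v))
  · ext v
    rw [vec_two_eq v, hη]
    simp
  · ext v
    simp
  · intro I ω' ρ' hI h0 h hω0 hρ0 t ht
    subst hω0 hρ0
    -- Every solution stays in the shear family, on which `d` is constant. This makes `ρ'` affine;
    -- then `hηdual` applies along the solution and makes `σ` affine, which determines the shear
    -- parameter.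
    have hsh := fun s hs => h.eq_shear hI h0 hρ hz hp hη hηp (t := s) hs
    have hρ' : ∀ s ∈ I, ρ' s = ρ' 0 + s • d (ω' 0) := by
      intro s hs
      ext v
      have h1 : ∀ u ∈ I, HasDerivWithinAt (fun u => ρ' u v - u * d (ω' 0) v) 0 I u := by
        intro u hu
        have h2 := (h.deriv_three u hu v).sub
          ((hasDerivAt_id u).mul_const (d (ω' 0) v)).hasDerivWithinAt
        rw [hsh u hu, hηd, one_mul, sub_self] at h2
        exact h2
      have h3 := eq_of_hasDerivWithinAt_zero hI h1 h0 hs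
      simp only [AlternatingMap.add_apply, AlternatingMap.smul_apply, smul_eq_mul]
      linarith
    have hσ' : ∀ s ∈ I, sigma (ω' s) - sigma (ω' 0) = s • d (dual (ω' 0) (ρ' 0)) := by
      intro s hs
      ext v
      have h1 : ∀ u ∈ I, HasDerivWithinAt
          (fun u => sigma (ω' u) v - u * d (dual (ω' 0) (ρ' 0)) v) 0 I u := by
        intro u hu
        have h2 := (h.deriv_four u hu v).sub
          ((hasDerivAt_id u).mul_const (d (dual (ω' 0) (ρ' 0)) v)).hasDerivWithinAt
        rw [hsh u hu, hρ' u hu, hηdual, one_mul, sub_self] at h2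
        exact h2
      have h3 := eq_of_hasDerivWithinAt_zero hI h1 h0 hs
      simp only [AlternatingMap.sub_apply, AlternatingMap.smul_apply, smul_eq_mul]
      linarith
    refine ⟨?_, hρ' t ht⟩
    change ω' t = η ((t • d (dual (ω' 0) (ρ' 0))) ![basis 0, basis 1, basis 3, basis 4] /
      pfaffian (coeff (ω' 0)))
    rw [← hσ' t ht]
    exact hsh t ht
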